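/- **Setting.** Let $C=(C_{ij})_{i,j\in I}$, $C_{ij}=\langle\alpha_i^\vee,\alpha_j\rangle$, be the Cartan matrix of a finite-dimensional simple complex Lie algebra, $d_i$ the relatively prime positive integers with $d_iC_{ij}=d_jC_{ji}$, $P=\bigoplus_i\mathbb Z\omega_i$ the weight lattice, $\alpha_i=\sum_jC_{ji}\omega_j$, $(\cdot,\cdot)$ the $\mathbb{Q}$-valued symmetric bilinear form on $P$ with $(\alpha_i,\omega_j)=d_j\delta_{ij}$, and $W$ the Weyl group, generated by $s_i(\omega_j)=\omega_j-\delta_{ij}\alpha_i$. Fix $q\in\mathbb C^\times$, not a root of unity, and $\hbar\in\mathbb C$ with $q=e^{\hbar}$; put $q^r=e^{\hbar r}$ for $r\in\mathbb Q$, $q_i=q^{d_i}$, $[n]_z=\frac{z^n-z^{-n}}{z-z^{-1}}$. Let $C(z)$ be the matrix with $C_{ii}(z)=z^{d_i}+z^{-d_i}$ and $C_{ij}(z)=[C_{ij}]_z$ for $i\ne j$, and $\widetilde C(z)=C(z)^{-1}$. Let $U_q(\hat{\mathfrak g})$ be the level-zero quantum affine algebra in its adjoint form, in Drinfeld's presentation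 with generators $x^\pm_{i,r}$ ($r\in\mathbb{Z}$), $h_{i,r}$ ($r\in\mathbb{Z}\setminus\{0\}$), $\bar k_i^{\pm1}$, where $k_i=\prod_j\bar k_j^{C_{ji}}$ and $$\phi_i^\pm(z)=\sum_{n\ge 0}\phi^\pm_{i,\pm n}z^{\pm n}=k_i^{\pm1}\exp\Bigl(\pm(q_i-q_i^{-1})\sum_{r>0}h_{i,\pm r}z^{\pm r}\Bigr).$$ Let $U_q(\hat{\mathfrak h})=\mathbb C[\bar k_j^{\pm1},h_{i,r}]$ be its commutative Cartan–Drinfeld algebra, with the elements $\tilde h_{i,r}=\sum_j[d_j]_q\widetilde C_{ji}(q^r)h_{j,r}$. Let $T_i$ be the automorphism of $U_q(\hat{\mathfrak h})$ (extended coefficientwise to $U_q(\hat{\mathfrak h})[[z]]$) with $$T_i(\tilde h_{j,r})=\tilde h_{j,r}-\delta_{ij}q_i^{-r}[d_i]_q\,h_{i,r},\qquad T_i(\bar k_j)=\bar k_j\,k_i^{-\delta_{ij}}.$$ Let $\mathcal M$ be the free abelian group (written multiplicatively) on symbols $Y_{i,a}$, $i\in I$, $a\in\mathbb C^\times$, let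 $$A_{i,a}=Y_{i,aq_i^{-1}}Y_{i,aq_i}\Bigl(\prod_{C_{ji}=-1}Y_{j,a}\prod_{C_{ji}=-2}Y_{j,aq^{-1}}Y_{j,aq}\prod_{C_{ji}=-3}Y_{j,aq^{-2}}Y_{j,a}Y_{j,aq^2}\Bigr)^{-1},$$ and let $T_i$ be Chari's operator on $\mathcal M$: the group endomorphism with $T_i(Y_{i,a})=Y_{i,a}A_{i,aq_i}^{-1}$ and $T_i(Y_{j,a})=Y_{j,a}$ for $j\ne i$. For $w\in W$ with a reduced expression $w=s_{i_1}\cdots s_{i_k}$ put $T_w=T_{i_1}\cdots T_{i_k}$, both on $U_q(\hat{\mathfrak h})[[z]]$ and on $\mathcal M$. A monomial $m=\prod Y_{j,a}^{u_{j,a}}$ has the weight $\varpi(m)=\sum u_{j,a}\,\omega_j$ and the $\ell$-weight $\Psi_i(z)=\sum_{n\ge0}\Psi_{i,n}z^n=\prod_a\bigl(q_i\tfrac{1-zaq_i^{-1}}{1-zaq_i}\bigr)^{u_{i,a}}$, $i\in I$. For a finite-dimensional $U_q(\hat{\mathfrak g})$-module $V$ of type 1 (that is, $V$ is the sum over $\lambda\in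 P$ of the subspaces on which every $\bar k_j$ acts by $q^{(\omega_j,\lambda)}$), let $V_m$ be the space of all $v\in V$ such that, for some $p$, $(\phi^+_{i,n}-\Psi_{i,n})^pv=0$ for all $i\in I$, $n\ge0$. For $h(z)\in U_q(\hat{\mathfrak h})[[z]]$ let $\langle h(z),m\rangle\in\mathbb C[[z]]$ be obtained by applying coefficientwise the algebra homomorphism $U_q(\hat{\mathfrak h})\to\mathbb C$ with $$\bar k_j\mapsto q^{(\omega_j,\varpi(m))},\qquad h_{i,r}\mapsto\frac{[r]_{q_i}}{r}\sum_a u_{i,a}a^r .$$ **Proposition.** (1) $\langle h(z),m\rangle$ is the eigenvalue of $h(z)$ on the $\ell$-weight space of $m$: for every finite-dimensional $U_q(\hat{\mathfrak g})$-module $V$ of type 1, every $m\in\mathcal M$, every $h(z)=\sum_n h_nz^n\in U_q(\hat{\mathfrak h})[[z]]$ and every $n\geq 0$, the space $V_m$ is contained in the generalized eigenspace of $h_n$ on $V$ with eigenvalue the $n$-th coefficient of $\langle h(z),m\rangle$. (2) The pairing is $W$-invariant: for all $w\in W$, all $h(z)\in U_q(\hat{\mathfrak h})[[z]]$ and all $m\in\mathcal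 M$, $$\langle T_w(h(z)),\,T_w(m)\rangle=\langle h(z),m\rangle,$$ where $T_w$ may be computed from any reduced expression of $w$ (the same one on both sides). -/

import Mathlib

open scoped PowerSeries

noncomputable section

namespace QAff

/-- An indecomposable Cartan matrix of finite type (equivalently, a finite-dimensional simple
complex Lie algebra), with its minimal symmetrizer `d`.  Convention: `C i j = ⟨α_i^∨, α_j⟩`. -/
structure CartanDatum (I : Type*) [Fintype I] [DecidableEq I] where
  C : Matrix I I ℤ
  d : I → ℕ
  diag : ∀ i, C i i = 2
  offDiag : ∀ i j, i ≠ j → C i j ≤ 0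
  d_pos : ∀ i, 0 < d i
  d_gcd : Finset.univ.gcd d = 1
  symm : ∀ i j, (d i : ℤ) * C i j = d j * C j i
  posDef : (Matrix.of fun i j => (d i : ℝ) * (C i j : ℝ)).PosDef
  indec : ∀ S : Set I, S.Nonempty → Sᶜ.Nonempty → ∃ i ∈ S, ∃ j ∈ Sᶜ, C i j ≠ 0

/-- The symmetric quantum integer `[n]_z`. -/
def qint (z : ℂ) (n : ℤ) : ℂ := (z ^ n - z ^ (-n)) / (z - z⁻¹)

/-- The quantum factorial `[n]_z!`. -/
def qfact (z : ℂ) (n : ℕ) : ℂ := ∏ k ∈ Finset.range n, qint z (k + 1)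

/-- The quantum binomial coefficient. -/
def qbinom (z : ℂ) (n k : ℕ) : ℂ := qfact z n / (qfact z k * qfact z (n - k))

/-- The group of Laurent monomials in the variables `Y_{i,a}`, `i ∈ I`, `a ∈ ℂˣ`, written
multiplicatively; a monomial is its family of exponents `u_{i,a}`. -/
abbrev Mon (I : Type*) := Multiplicative (I × ℂˣ →₀ ℤ)

/-- The algebra `U_q(ĥ)` at level zero, in its adjoint form: the commutative algebra
`ℂ[k̄_j^{±1}, h_{i,r} : i, j ∈ I, r ∈ ℤ ∖ {0}]`.  The group algebra of `P = ⊕ ℤ ω_j` (weights are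
written in the coordinates of the fundamental weights) is the algebra of the `k̄_j^{±1}`. -/
abbrev CartanAlg (I : Type*) :=
  MvPolynomial (I × {r : ℤ // r ≠ 0}) (AddMonoidAlgebra ℂ (I → ℤ))

section Basic

variable {I : Type*}

/-- The variable `Y_{i,a}`. -/
def Y (i : I) (a : ℂˣ) : Mon I := Multiplicative.ofAdd (Finsupp.single (i, a) 1)

/-- The group homomorphism out of the group of monomials with prescribed values on the `Y_{i,a}`. -/
def monLift {G : Type*} [CommGroup G] (f : I → ℂˣ → G) : Mon I →* G where
  toFun m := m.toAdd.prod fun p n => f p.1 p.2 ^ n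
  map_one' := Finsupp.prod_zero_index
  map_mul' _ _ :=
    Finsupp.prod_add_index' (fun _ => zpow_zero _) (fun _ _ _ => zpow_add _ _ _)

theorem monLift_Y {G : Type*} [CommGroup G] (f : I → ℂˣ → G) (i : I) (a : ℂˣ) :
    monLift f (Y i a) = f i a := by
  simp [monLift, Y]

/-- The element of `U_q(ĥ)` attached to a weight `lam = ∑ lam_j ω_j`, namely `∏ k̄_j^{lam_j}`. -/
def kwt (lam : I → ℤ) : CartanAlg I := MvPolynomial.C (AddMonoidAlgebra.single lam 1)

theorem kwt_add (lam mu : I → ℤ) : kwt (lam + mu) = kwt lam * kwt mu := by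
  simp [kwt, ← map_mul, AddMonoidAlgebra.single_mul_single]

/-- The generator `h_{i,r}`, `r ≠ 0`. -/
def hgen (i : I) (r : {r : ℤ // r ≠ 0}) : CartanAlg I := MvPolynomial.X (i, r)

/-- The power series `∑_{r > 0} h_{i, e r} z^r`, for a sign `e`. -/
def hSeries (e : ℤˣ) (i : I) : (CartanAlg I)⟦X⟧ :=
  PowerSeries.mk fun n =>
    if hn : n = 0 then 0
    else hgen i ⟨(e : ℤ) * n, mul_ne_zero e.ne_zero (Int.natCast_ne_zero.mpr hn)⟩

/-- The power series `1 - c z`, as an invertible power series. -/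
def linUnit (c : ℂ) : (ℂ⟦X⟧)ˣ :=
  IsUnit.unit (a := 1 - PowerSeries.C c * PowerSeries.X)
    (PowerSeries.isUnit_iff_constantCoeff.mpr (by simp))

/-- The weight of a monomial, with `Y_{i,a} ↦ ω_i`, in the coordinates of fundamental weights. -/
def wt [DecidableEq I] (m : Mon I) (i : I) : ℤ :=
  m.toAdd.sum fun p n => if p.1 = i then n else 0

theorem wt_mul [DecidableEq I] (m m' : Mon I) : wt (m * m') = wt m + wt m' := by
  funext i
  refine Finsupp.sum_add_index' (fun p => ?_) (fun p a b => ?_)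
  · split_ifs <;> rfl
  · split_ifs <;> simp

end Basic

section Datum

variable {I : Type*} [Fintype I] [DecidableEq I] (D : CartanDatum I) (q : ℂˣ) (hbar : ℂ)

/-- `q_i = q^{d_i}`. -/
def qi (i : I) : ℂˣ := q ^ D.d i

/-- The quantum Cartan matrix `C(z)`: `C_{ii}(z) = z^{d_i} + z^{-d_i}`, and
`C_{ij}(z) = [C_{ij}]_z` for `i ≠ j`. -/
def qCartan (z : ℂ) : Matrix I I ℂ :=
  Matrix.of fun i j => if i = j then z ^ D.d i + (z ^ D.d i)⁻¹ else qint z (D.C i j)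

/-- The simple root `α_i = ∑_j C_{ji} ω_j`. -/
def simpleRoot (i : I) : I → ℤ := fun j => D.C j i

/-- The form on `P`, with `(α_i, ω_j) = d_j δ_{ij}`, that is `(ω_i, ω_j) = d_i (C⁻¹)_{ij}`. -/
def form (lam mu : I → ℤ) : ℚ :=
  ∑ i, ∑ j, (lam i : ℚ) * (mu j : ℚ) * ((D.d i : ℚ) * (D.C.map (Int.cast : ℤ → ℚ))⁻¹ i j)

theorem form_add_left (lam lam' mu : I → ℤ) :
    form D (lam + lam') mu = form D lam mu + form D lam' mu := by
  simp [form, add_mul, Finset.sum_add_distrib]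

/-- `q^{(lam, mu)}`, where `q^r = e^{hbar r}` for rational `r`. -/
def qform (lam mu : I → ℤ) : ℂ := Complex.exp (hbar * (form D lam mu : ℚ))

/-! ### Weyl group and reduced words -/

/-- The simple reflection `s_i` of `P`: `s_i(ω_j) = ω_j - δ_{ij} α_i`. -/
def simpleRefl (i : I) : (I → ℤ) ≃ₗ[ℤ] (I → ℤ) where
  toFun lam := lam - lam i • simpleRoot D i
  invFun lam := lam - lam i • simpleRoot D i
  left_inv lam := by
    funext j
    simp [simpleRoot, D.diag]
    ring
  right_inv lam := by
    funext j
    simp [simpleRoot, D.diag]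
    ring
  map_add' lam mu := by
    funext j
    simp
    ring
  map_smul' c lam := by
    funext j
    simp
    ring

/-- The Weyl group, realized (faithfully) on the weight lattice. -/
def weylGroup : Subgroup (((I → ℤ) ≃ₗ[ℤ] (I → ℤ))) := Subgroup.closure (Set.range (simpleRefl D))

/-- `l = [i_1, …, i_k]` is a reduced word of `w`: `w = s_{i_1} ⋯ s_{i_k}` with `k` minimal. -/
def IsReducedWord (w : (I → ℤ) ≃ₗ[ℤ] (I → ℤ)) (l : List I) : Prop :=
  (l.map (simpleRefl D)).prod = w ∧
    ∀ l' : List I, (l'.map (simpleRefl D)).prod = w → l.length ≤ l'.length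

/-! ### Monomials: simple root monomials, Chari's operators, `ℓ`-weights -/

/-- The simple root monomial `A_{i,a}`. -/
def A (i : I) (a : ℂˣ) : Mon I :=
  Y i (a * (qi D q i)⁻¹) * Y i (a * qi D q i) *
    ((∏ j with D.C j i = -1, Y j a) *
      (∏ j with D.C j i = -2, Y j (a * q⁻¹) * Y j (a * q)) *
      (∏ j with D.C j i = -3, Y j (a * (q ^ 2)⁻¹) * Y j a * Y j (a * q ^ 2)))⁻¹

/-- Chari's operator `T_i` on monomials: `T_i(Y_{i,a}) = Y_{i,a} A_{i,a q_i}⁻¹` and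
`T_i(Y_{j,a}) = Y_{j,a}` for `j ≠ i`. -/
def braidMon (i : I) : Monoid.End (Mon I) :=
  monLift fun j a => if j = i then Y i a * (A D q i (a * qi D q i))⁻¹ else Y j a

/-- The operator `T_{i_1} ⋯ T_{i_k}` on monomials; it is `T_w` when the word is reduced for `w`. -/
def braidMonWord (l : List I) : Monoid.End (Mon I) := (l.map (braidMon D q)).prod

/-- The prefundamental `ℓ`-weight `Ψ_{i,a}`: `1 - z a` at the place `i`, and `1` elsewhere. -/
def prefund (i : I) (a : ℂˣ) : I → (ℂ⟦X⟧)ˣ := Pi.mulSingle i (linUnit a)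

/-- The constant `ℓ`-weight `[lam] = (q_j^{lam(α_j^∨)})_j`. -/
def constLWeight (lam : I → ℤ) : I → (ℂ⟦X⟧)ˣ :=
  fun j => Units.map (PowerSeries.C (R := ℂ)).toMonoidHom (qi D q j ^ lam j)

/-- The `ℓ`-weight of a monomial:
`Y_{i,a} ↦ [ω_i] Ψ_{i, a q_i⁻¹} Ψ_{i, a q_i}⁻¹`. -/
def lWeight : Mon I →* (I → (ℂ⟦X⟧)ˣ) :=
  monLift fun i a => constLWeight D q (Pi.single i 1) *
    prefund i (a * (qi D q i)⁻¹) * (prefund i (a * qi D q i))⁻¹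

/-! ### The algebra `U_q(ĥ)` and its braid operators -/

/-- `k_i = ∏_j k̄_j^{C_{ji}}`. -/
def kgen (i : I) : CartanAlg I := kwt (simpleRoot D i)

/-- The power series (in `z` for the sign `+`, in `z⁻¹` for the sign `-`)
`k_i^{±1} exp(± (q_i - q_i⁻¹) ∑_{r > 0} h_{i,±r} z^{±r})`. -/
def phiSeries (e : ℤˣ) (i : I) : (CartanAlg I)⟦X⟧ :=
  PowerSeries.C (kwt ((e : ℤ) • simpleRoot D i)) *
    (PowerSeries.exp ℂ).subst
      ((((e : ℤ) : ℂ) * ((qi D q i : ℂ) - (qi D q i : ℂ)⁻¹)) • hSeries e i)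

/-- The elements `φ^±_{i,n}`, `n ∈ ℤ`; `φ^+_{i,n} = 0` for `n < 0`, `φ^-_{i,n} = 0` for `n > 0`. -/
def phi (e : ℤˣ) (i : I) (n : ℤ) : CartanAlg I :=
  if 0 ≤ (e : ℤ) * n then PowerSeries.coeff n.natAbs (phiSeries D q e i) else 0

/-- The element `h̃_{i,r} = ∑_j [d_j]_q C̃_{ji}(q^r) h_{j,r}`, where `C̃(z) = C(z)⁻¹`. -/
def htilde (i : I) (r : {r : ℤ // r ≠ 0}) : CartanAlg I :=
  ∑ j, (qint q (D.d j) * (qCartan D ((q : ℂ) ^ (r : ℤ)))⁻¹ j i) • hgen j r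

/-- The automorphism of the group algebra of `P` induced by `s_i`. -/
def braidTorus (i : I) : AddMonoidAlgebra ℂ (I → ℤ) →ₐ[ℂ] AddMonoidAlgebra ℂ (I → ℤ) :=
  AddMonoidAlgebra.mapDomainAlgHom ℂ ℂ ((simpleRefl D i).toAddEquiv : (I → ℤ) →+ (I → ℤ))

/-- The operator `T_i` on `U_q(ĥ)`, which is
`T_i(h̃_{j,r}) = h̃_{j,r} - δ_{ij} q_i^{-r} [d_i]_q h_{i,r}` and `T_i(k̄_j) = k̄_j k_i^{-δ_{ij}}`
(see `braidCartan_htilde` and `braidCartan_kbar`), written on the generators `h_{j,r}`. -/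
def braidCartan (i : I) : CartanAlg I →ₐ[ℂ] CartanAlg I :=
  MvPolynomial.aevalTower
    ((IsScalarTower.toAlgHom ℂ (AddMonoidAlgebra ℂ (I → ℤ)) (CartanAlg I)).comp (braidTorus D i))
    fun p => hgen p.1 p.2 -
      ((qi D q i : ℂ) ^ (-(p.2 : ℤ)) * qCartan D ((q : ℂ) ^ (p.2 : ℤ)) i p.1 *
        (qint q (D.d i) / qint q (D.d p.1))) • hgen i p.2

theorem braidCartan_kwt (i : I) (lam : I → ℤ) :
    braidCartan D q i (kwt lam) = kwt (simpleRefl D i lam) := by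
  simp [braidCartan, kwt, braidTorus, MvPolynomial.algebraMap_eq]

theorem braidCartan_kbar (i j : I) :
    braidCartan D q i (kwt (Pi.single j 1)) =
      kwt (Pi.single j 1) * (if i = j then kwt (-simpleRoot D i) else 1) := by
  rw [braidCartan_kwt]
  by_cases h : i = j
  · subst h
    rw [if_pos rfl, ← kwt_add]
    congr 1
    funext l
    simp [simpleRefl, sub_eq_add_neg]
  · rw [if_neg h, mul_one]
    congr 1
    funext l
    simp [simpleRefl, h]

theorem qint_ne_zero (hq : ∀ n : ℕ, 0 < n → q ^ n ≠ 1) (n : ℕ) (hn : 0 < n) :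
    qint (q : ℂ) n ≠ 0 := by
  have key : ∀ k : ℕ, 0 < k → (q : ℂ) ^ (k : ℤ) - (q : ℂ) ^ (-(k : ℤ)) ≠ 0 := by
    intro k hk h0
    have h1 : (q : ℂ) ^ (k : ℤ) = (q : ℂ) ^ (-(k : ℤ)) := sub_eq_zero.mp h0
    have h2 : (q : ℂ) ^ (k : ℤ) * (q : ℂ) ^ (k : ℤ) = 1 := by
      conv_lhs => rw [h1]
      nth_rewrite 2 [← h1]
      rw [← zpow_add₀ q.ne_zero]
      simp
    apply hq (2 * k) (by omega)
    ext
    rw [Units.val_pow_eq_pow_val, Units.val_one, two_mul, pow_add]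
    simpa using h2
  unfold qint
  have h1 := key 1 one_pos
  simp only [Nat.cast_one, zpow_one, zpow_neg] at h1
  exact div_ne_zero (key n hn) h1

theorem braidCartan_htilde (hq : ∀ n : ℕ, 0 < n → q ^ n ≠ 1) (i j : I) (r : {r : ℤ // r ≠ 0})
    (hdet : (qCartan D ((q : ℂ) ^ (r : ℤ))).det ≠ 0) :
    braidCartan D q i (htilde D q j r) = htilde D q j r -
      (if i = j then ((qi D q i : ℂ) ^ (-(r : ℤ)) * qint q (D.d i)) • hgen i r else 0) := by
  set M := qCartan D ((q : ℂ) ^ (r : ℤ)) with hM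
  have hinv : ∑ l, M i l * M⁻¹ l j = if i = j then 1 else 0 := by
    have := congrFun (congrFun (Matrix.mul_nonsing_inv M (isUnit_iff_ne_zero.mpr hdet)) i) j
    simpa [Matrix.mul_apply, Matrix.one_apply] using this
  have hT : ∀ l, braidCartan D q i (hgen l r) = hgen l r -
      ((qi D q i : ℂ) ^ (-(r : ℤ)) * M i l * (qint q (D.d i) / qint q (D.d l))) • hgen i r := by
    intro l
    simp [braidCartan, hgen, hM]
  unfold htilde
  rw [map_sum]
  simp_rw [map_smul, hT, smul_sub, Finset.sum_sub_distrib, smul_smul, ← Finset.sum_smul]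
  congr 1
  have hs : ∑ l, qint q (D.d l) * M⁻¹ l j *
      ((qi D q i : ℂ) ^ (-(r : ℤ)) * M i l * (qint q (D.d i) / qint q (D.d l))) =
      ((qi D q i : ℂ) ^ (-(r : ℤ)) * qint q (D.d i)) * ∑ l, M i l * M⁻¹ l j := by
    rw [Finset.mul_sum]
    refine Finset.sum_congr rfl fun l _ => ?_
    have := qint_ne_zero q hq (D.d l) (D.d_pos l)
    field_simp
  rw [hs, hinv]
  split_ifs <;> simp

/-- The operator `T_{i_1} ⋯ T_{i_k}` on `U_q(ĥ)`; it is `T_w` when the word is reduced for `w`. -/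
def braidCartanWord (l : List I) : CartanAlg I →ₐ[ℂ] CartanAlg I :=
  (l.map (braidCartan D q)).prod

/-- The coefficientwise extension of `T_{i_1} ⋯ T_{i_k}` to `U_q(ĥ)[[z]]`. -/
def braidSeriesWord (l : List I) : (CartanAlg I)⟦X⟧ →+* (CartanAlg I)⟦X⟧ :=
  PowerSeries.map (braidCartanWord D q l : CartanAlg I →+* CartanAlg I)

/-! ### The pairing -/

/-- The character `U_q(ĥ) → ℂ` attached to a monomial `m = ∏ Y_{j,a}^{u_{j,a}}`:
`k̄_j ↦ q^{(ω_j, wt m)}` and `h_{i,r} ↦ ([r]_{q_i} / r) ∑_a u_{i,a} a^r`. -/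
def character (m : Mon I) : CartanAlg I →ₐ[ℂ] ℂ :=
  MvPolynomial.aevalTower
    (AddMonoidAlgebra.lift ℂ ℂ (I → ℤ)
      { toFun := fun lam => qform D hbar lam.toAdd (wt m)
        map_one' := by simp [qform, form]
        map_mul' := fun lam mu => by
          simp [qform, form_add_left, mul_add, Complex.exp_add] })
    fun p => (qint (qi D q p.1) p.2 / ((p.2 : ℤ) : ℂ)) *
      m.toAdd.sum fun x u => if x.1 = p.1 then (u : ℂ) * (x.2 : ℂ) ^ (p.2 : ℤ) else 0

/-- The pairing `⟨h(z), m⟩ ∈ ℂ[[z]]`. -/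
def pairing (h : (CartanAlg I)⟦X⟧) (m : Mon I) : ℂ⟦X⟧ :=
  PowerSeries.map (character D q hbar m : CartanAlg I →+* ℂ) h

/-! ### The quantum affine algebra and its modules -/

/-- Generators of `U_q(ĝ)`: the `x^±_{i,r}`, and the elements of `U_q(ĥ)`. -/
inductive Gen (I : Type*)
  | x (e : ℤˣ) (i : I) (r : ℤ) : Gen I
  | car (a : CartanAlg I) : Gen I

/-- The generator `x^±_{i,r}` in the free algebra. -/
def fx (e : ℤˣ) (i : I) (r : ℤ) : FreeAlgebra ℂ (Gen I) := FreeAlgebra.ι ℂ (Gen.x e i r)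

/-- The generator attached to an element of `U_q(ĥ)` in the free algebra. -/
def fc (a : CartanAlg I) : FreeAlgebra ℂ (Gen I) := FreeAlgebra.ι ℂ (Gen.car a)

/-- Drinfeld's relations at level zero. The first three say that `U_q(ĥ)` maps to the quotient by
a homomorphism of algebras. -/
inductive DrinfeldRel : FreeAlgebra ℂ (Gen I) → FreeAlgebra ℂ (Gen I) → Prop
  | car_add (a b : CartanAlg I) : DrinfeldRel (fc (a + b)) (fc a + fc b)
  | car_mul (a b : CartanAlg I) : DrinfeldRel (fc (a * b)) (fc a * fc b)
  | car_scalar (t : ℂ) :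
      DrinfeldRel (fc (algebraMap ℂ (CartanAlg I) t)) (algebraMap ℂ (FreeAlgebra ℂ (Gen I)) t)
  | k_x (i : I) (e : ℤˣ) (j : I) (r : ℤ) :
      DrinfeldRel (fc (kwt (Pi.single i 1)) * fx e j r)
        ((if i = j then (qi D q i : ℂ) ^ (e : ℤ) else 1) •
          (fx e j r * fc (kwt (Pi.single i 1))))
  | h_x (i : I) (n : {r : ℤ // r ≠ 0}) (e : ℤˣ) (j : I) (r : ℤ) :
      DrinfeldRel (fc (hgen i n) * fx e j r - fx e j r * fc (hgen i n))
        ((((e : ℤ) : ℂ) * (qint (qi D q i) ((n : ℤ) * D.C i j) / ((n : ℤ) : ℂ))) •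
          fx e j (n + r))
  | x_x_opp (i j : I) (r s : ℤ) :
      DrinfeldRel (fx 1 i r * fx (-1) j s - fx (-1) j s * fx 1 i r)
        (if i = j then ((qi D q i : ℂ) - (qi D q i : ℂ)⁻¹)⁻¹ •
          fc (phi D q 1 i (r + s) - phi D q (-1) i (r + s)) else 0)
  | x_x (e : ℤˣ) (i j : I) (r s : ℤ) :
      DrinfeldRel
        (fx e i (r + 1) * fx e j s -
          ((qi D q i : ℂ) ^ ((e : ℤ) * D.C i j)) • (fx e j s * fx e i (r + 1)))
        (((qi D q i : ℂ) ^ ((e : ℤ) * D.C i j)) • (fx e i r * fx e j (s + 1)) -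
          fx e j (s + 1) * fx e i r)
  | serre (e : ℤˣ) (i j : I) (hij : i ≠ j) (N : ℕ) (hN : (N : ℤ) = 1 - D.C i j)
      (r : Fin N → ℤ) (s : ℤ) :
      DrinfeldRel
        (∑ p : Equiv.Perm (Fin N), ∑ k ∈ Finset.range (N + 1),
          ((-1) ^ k * qbinom (qi D q i) N k) •
            ((((List.ofFn fun t => fx e i (r (p t))).take k).prod * fx e j s) *
              ((List.ofFn fun t => fx e i (r (p t))).drop k).prod))
        0

/-- The quantum affine algebra `U_q(ĝ)` of level zero (adjoint form), in Drinfeld's presentation. -/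
abbrev QuantumAffine := RingQuot (DrinfeldRel D q)

/-- The canonical homomorphism `U_q(ĥ) → U_q(ĝ)`. -/
def cartanMap : CartanAlg I →ₐ[ℂ] QuantumAffine D q where
  toFun a := RingQuot.mkAlgHom ℂ (DrinfeldRel D q) (fc a)
  map_one' := by
    have := RingQuot.mkAlgHom_rel ℂ (DrinfeldRel.car_scalar (D := D) (q := q) 1)
    rwa [map_one, map_one, map_one] at this
  map_mul' a b := by
    have := RingQuot.mkAlgHom_rel ℂ (DrinfeldRel.car_mul (D := D) (q := q) a b)
    simpa using this
  map_zero' := by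
    have := RingQuot.mkAlgHom_rel ℂ (DrinfeldRel.car_scalar (D := D) (q := q) 0)
    simpa using this
  map_add' a b := by
    have := RingQuot.mkAlgHom_rel ℂ (DrinfeldRel.car_add (D := D) (q := q) a b)
    simpa using this
  commutes' t := by
    have := RingQuot.mkAlgHom_rel ℂ (DrinfeldRel.car_scalar (D := D) (q := q) t)
    rw [AlgHom.commutes] at this
    exact this

section Modules

variable {D q}
variable {V : Type*} [AddCommGroup V] [Module ℂ V]
  (ρ : QuantumAffine D q →ₐ[ℂ] Module.End ℂ V)

/-- The action on a `U_q(ĝ)`-module of an element of `U_q(ĥ)`. -/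
def act (a : CartanAlg I) : Module.End ℂ V := ρ (cartanMap D q a)

/-- The weight space of weight `lam ∈ P`: `k̄_j` acts on it by `q^{(ω_j, lam)}`, so that `k_j` acts
by `q^{(α_j, lam)}`. -/
def weightSpace (lam : I → ℤ) : Submodule ℂ V :=
  ⨅ j, Module.End.eigenspace (act ρ (kwt (Pi.single j 1))) (qform D hbar (Pi.single j 1) lam)

/-- Type 1 modules: the module is the sum of its weight spaces, the weights being in `P`. -/
def IsTypeOne : Prop := ⨆ lam, weightSpace hbar ρ lam = ⊤

/-- The `ℓ`-weight space of the monomial `m`: the vectors `v` such that for some `p`,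
`(φ^+_{i,n} - Ψ_{i,n})^p v = 0` for all `i ∈ I`, `n ≥ 0`, where `Ψ` is the `ℓ`-weight of `m`. -/
def lWeightSpace (m : Mon I) : Submodule ℂ V where
  carrier := {v | ∃ p : ℕ, ∀ (i : I) (n : ℕ),
    ((act ρ (phi D q 1 i n) -
      algebraMap ℂ (Module.End ℂ V) (PowerSeries.coeff n (lWeight D q m i : ℂ⟦X⟧))) ^ p) v = 0}
  zero_mem' := ⟨0, fun _ _ => map_zero _⟩
  add_mem' := by
    rintro v w ⟨p, hp⟩ ⟨p', hp'⟩
    refine ⟨p + p', fun i n => ?_⟩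
    rw [map_add]
    nth_rewrite 1 [add_comm p p']
    rw [pow_add, pow_add, Module.End.mul_apply, Module.End.mul_apply, hp i n, hp' i n]
    simp
  smul_mem' := by
    rintro t v ⟨p, hp⟩
    exact ⟨p, fun i n => by rw [map_smul, hp i n, smul_zero]⟩

end Modules

end Datum

end QAff

end

/-! For the eigenvalue statement, the operators of `U_q(ĥ)` commute and preserve `V_m`, so it is
enough to identify the character `χ` by which `U_q(ĥ)` acts on a common eigenvector in `V_m`
(`le_maxGenEigenspace_of_common_eigenvector`, `eq_character_of_eigenvector`). Membership in `V_m`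
gives `χ` on the `φ^+_{i,n}`; type 1 and the constant terms then give the weight, because `q` is not
a root of unity. The `φ^-_{i,n}` do not occur in the definition of `V_m`. They are recovered from
finite-dimensionality: the normalized commutator with `h_{i,1}` shifts `x^+_{i,r}` to `x^+_{i,r+1}`,
so its minimal polynomial gives a linear recurrence, valid for all integers `n`, on `φ^+_{i,n} -
φ^-_{i,n}` (`exists_recurrence`). Hence the two series are expansions at `0` and `∞` of one rational
function, and the first determines the second (`IsBalanced.eq`). The explicit character of `m` has
the same property (`isBalanced_phiChar`), so both characters agree on all `φ^±_{i,n}`, and taking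
logarithms they agree on the `h_{i,r}`.

For the invariance, induction on the word leaves a single `T_i`, to be checked on generators
(`character_braid`). On the torus it is the invariance of the form under `s_i`. On `h_{j,r}` both
operators are given by the quantum Cartan matrix at `q^r`, and the identity comes down to the
symmetry of `[d_i]_z [C_{ij}]_z`. That symmetry needs the shorter root of a multiple bond to have `d
= 1`, which is proved from positive definiteness, indecomposability and the gcd condition
(`bond_cases`), without the classification. -/

noncomputable section

namespace QAff

/-! ### Root lengths in an indecomposable Cartan matrix of finite type -/

namespace CartanDatum
variable {I : Type*} [Fintype I] [DecidableEq I] (D : CartanDatum I)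

/-- The symmetrized Cartan form on the real root space, in the basis of simple roots. -/
def B (x y : I → ℝ) : ℝ := ∑ i, ∑ j, x i * ((D.d i : ℝ) * D.C i j) * y j

theorem B_add_left (x x' y : I → ℝ) : D.B (x + x') y = D.B x y + D.B x' y := by
  simp [B, add_mul, Finset.sum_add_distrib]

theorem symm_real (i j : I) : (D.d i : ℝ) * D.C i j = D.d j * D.C j i := by
  exact_mod_cast D.symm i j

theorem B_comm (x y : I → ℝ) : D.B x y = D.B y x := by
  unfold B
  rw [Finset.sum_comm]
  refine Finset.sum_congr rfl fun i _ => Finset.sum_congr rfl fun j _ => ?_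
  rw [D.symm_real j i]
  ring

theorem B_add_right (x y y' : I → ℝ) : D.B x (y + y') = D.B x y + D.B x y' := by
  rw [B_comm, B_add_left, B_comm, D.B_comm y']

theorem B_smul_left (c : ℝ) (x y : I → ℝ) : D.B (c • x) y = c * D.B x y := by
  simp [B, Finset.mul_sum, mul_assoc]

theorem B_smul_right (c : ℝ) (x y : I → ℝ) : D.B x (c • y) = c * D.B x y := by
  rw [B_comm, B_smul_left, B_comm]

theorem B_single_right (x : I → ℝ) (j : I) :
    D.B x (Pi.single j 1) = ∑ i, x i * ((D.d i : ℝ) * D.C i j) := by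
  simp [B, Pi.single_apply]

theorem B_single_single (i j : I) :
    D.B (Pi.single i 1) (Pi.single j 1) = D.d i * D.C i j := by
  simp [B_single_right, Pi.single_apply]

theorem B_single_self (i : I) : D.B (Pi.single i 1) (Pi.single i 1) = 2 * D.d i := by
  rw [B_single_single, D.diag]
  push_cast
  ring

theorem B_pos {x : I → ℝ} (hx : x ≠ 0) : 0 < D.B x x := by
  have h := D.posDef.dotProduct_mulVec_pos hx
  simpa [B, dotProduct, Matrix.mulVec, Finset.mul_sum, mul_assoc] using h

theorem d_pos_real (i : I) : (0 : ℝ) < D.d i := by exact_mod_cast D.d_pos i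

/-- The component of `α_j` orthogonal to `α_i` has positive norm, and this norm is `d_j (4 - C_{ij}
C_{ji}) / 2`. -/
theorem C_mul_C_lt {i j : I} (hij : i ≠ j) : D.C i j * D.C j i < 4 := by
  have hd := D.d_pos_real i
  have hd' := D.d_pos_real j
  have hne : Pi.single j 1 + (-(D.C i j : ℝ) / 2) • (Pi.single i 1 : I → ℝ) ≠ 0 := by
    intro h
    have := congrFun h j
    simp [hij.symm] at this
  have h := D.B_pos hne
  simp only [B_add_left, B_add_right, B_smul_left, B_smul_right, B_single_self,
    B_single_single] at h
  have hs := D.symm_real i j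
  have h2 : (0 : ℝ) < D.d j * (4 - D.C i j * D.C j i) := by
    rw [← hs] at h
    have : (D.d j : ℝ) * (D.C i j * D.C j i) = D.d i * D.C i j * D.C i j := by rw [hs]; ring
    rw [mul_sub, this]
    nlinarith
  have h3 := pos_of_mul_pos_right h2 hd'.le
  have h4 : (D.C i j * D.C j i : ℝ) < 4 := by linarith
  exact_mod_cast h4

theorem C_eq_zero_symm {i j : I} (h : D.C i j = 0) : D.C j i = 0 := by
  have hs := D.symm i j
  rw [h, mul_zero] at hs
  have := D.d_pos j
  rcases mul_eq_zero.mp hs.symm with h' | h'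
  · omega
  · exact h'

theorem C_le_neg_one {i j : I} (hij : i ≠ j) (h : D.C i j ≠ 0) : D.C i j ≤ -1 := by
  have := D.offDiag i j hij
  omega

theorem neg_three_le_C {i j : I} (hij : i ≠ j) : -3 ≤ D.C i j := by
  by_cases h : D.C i j = 0
  · omega
  · have h1 := D.C_le_neg_one hij h
    have h2 := D.C_le_neg_one hij.symm fun h' => h (D.C_eq_zero_symm h')
    have := D.C_mul_C_lt hij
    nlinarith

/-- A lower bound for the projections of neighbouring vectors of different lengths. -/
theorem two_mul_d_mul_d_le {i j : I} (hd : D.d i ≠ D.d j) (hC : D.C i j ≠ 0) :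
    2 * (D.d i : ℝ) * D.d j ≤ ((D.d i : ℝ) * D.C i j) ^ 2 := by
  have hij : i ≠ j := fun h => hd (by rw [h])
  have h1 := D.C_le_neg_one hij hC
  have h2 := D.C_le_neg_one hij.symm fun h' => hC (D.C_eq_zero_symm h')
  -- Two entries `-1` would force equal lengths by symmetrizability.
  have h3 : 2 ≤ D.C i j * D.C j i := by
    by_contra hlt
    have e1 : D.C i j = -1 := by nlinarith
    have e2 : D.C j i = -1 := by nlinarith
    have hs := D.symm i j
    rw [e1, e2] at hs
    omega
  have h4 : (2 : ℝ) ≤ D.C i j * D.C j i := by exact_mod_cast h3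
  have h5 : ((D.d i : ℝ) * D.C i j) ^ 2 = (D.d i * D.d j) * (D.C i j * D.C j i) := by
    rw [sq]
    nth_rewrite 2 [D.symm_real i j]
    ring
  rw [h5]
  have := mul_pos (D.d_pos_real i) (D.d_pos_real j)
  nlinarith

/-- The vertices joined to `i` by the support of a vector no longer than `α_i`, made of simple roots
of the length of `α_i`. -/
def Linked (i u : I) : Prop :=
  ∃ g : I → ℝ, (∀ v, g v = 0 ∨ 1 ≤ g v) ∧ (∀ v, g v ≠ 0 → D.d v = D.d i) ∧ 1 ≤ g i ∧ 1 ≤ g u ∧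
    D.B g g ≤ 2 * D.d i

theorem linked_refl (i : I) : D.Linked i i := by
  refine ⟨Pi.single i 1, fun v => ?_, fun v hv => ?_, by simp, by simp, (D.B_single_self i).le⟩
  · by_cases h : v = i
    · right; simp [h]
    · left; simp [h]
  · by_cases h : v = i
    · rw [h]
    · simp [h] at hv

/-- The diagonal term vanishes with `g v` and all others are nonpositive, so the term of `u` alone
is an upper bound. -/
theorem B_single_right_le {g : I → ℝ} (hg : ∀ v, 0 ≤ g v) {u v : I} (huv : u ≠ v)
    (hu : 1 ≤ g u) (hv : g v = 0) : D.B g (Pi.single v 1) ≤ D.d u * D.C u v := by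
  rw [B_single_right]
  have hterm : ∀ i, i ≠ v → (D.d i : ℝ) * D.C i v ≤ 0 := fun i hi =>
    mul_nonpos_of_nonneg_of_nonpos (D.d_pos_real i).le (by exact_mod_cast D.offDiag i v hi)
  have hle : ∀ i, g i * ((D.d i : ℝ) * D.C i v) ≤ 0 := by
    intro i
    by_cases hi : i = v
    · simp [hi, hv]
    · exact mul_nonpos_of_nonneg_of_nonpos (hg i) (hterm i hi)
  rw [← Finset.add_sum_erase _ _ (Finset.mem_univ u)]
  have h1 : ∑ i ∈ Finset.univ.erase u, g i * ((D.d i : ℝ) * D.C i v) ≤ 0 :=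
    Finset.sum_nonpos fun i _ => hle i
  have h2 := hterm u huv
  nlinarith

/-- Adding `α_v` to `g` changes the norm by `2 d_i + 2 B(g, α_v)`, and `B(g, α_v) ≤ d_u C_{uv} ≤
-d_i`, so the norm does not grow. -/
theorem linked_step {i u v : I} (h : D.Linked i u) (hd : D.d v = D.d i) (hC : D.C u v ≠ 0) :
    D.Linked i v := by
  obtain ⟨g, h0, hs, hi, hu, hn⟩ := h
  rcases h0 v with hv | hv
  · have huv : u ≠ v := by
      rintro rfl
      linarith
    have hdu : D.d u = D.d i := hs u (by linarith)
    have hiv : i ≠ v := by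
      rintro rfl
      linarith
    have hg : ∀ w, 0 ≤ g w := fun w => by rcases h0 w with h | h <;> linarith
    refine ⟨g + Pi.single v 1, fun w => ?_, fun w hw => ?_, ?_, ?_, ?_⟩
    · by_cases hwv : w = v
      · subst hwv; simp [hv]
      · simpa [hwv] using h0 w
    · by_cases hwv : w = v
      · rw [hwv, hd]
      · exact hs w (by simpa [hwv] using hw)
    · simpa [hiv] using hi
    · simp [hv]
    · rw [B_add_left, B_add_right, B_add_right, D.B_comm (Pi.single v 1) g, B_single_self, hd]
      have h1 := D.B_single_right_le hg huv hu hv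
      have h2 : (D.C u v : ℝ) ≤ -1 := by exact_mod_cast D.C_le_neg_one huv hC
      have := D.d_pos_real i
      rw [hdu] at h1
      nlinarith
  · exact ⟨g, h0, hs, hi, hv, hn⟩

/-- A connected set of simple roots of one length has at most one neighbour of another length. -/
theorem eq_of_linked {i j u v : I} (h : D.Linked i u) (hj : D.d j ≠ D.d i) (hv : D.d v ≠ D.d i)
    (hij : D.C i j ≠ 0) (huv : D.C u v ≠ 0) : v = j := by
  obtain ⟨g, h0, hs, hi, hu, hn⟩ := h
  by_contra hvj
  have hg : ∀ w, 0 ≤ g w := fun w => by rcases h0 w with h | h <;> linarith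
  have hdu : D.d u = D.d i := hs u (by linarith)
  have gj : g j = 0 := by_contra fun h => hj (hs j h)
  have gv : g v = 0 := by_contra fun h => hv (hs v h)
  have b1 := D.B_single_right_le hg (fun e => hj (by rw [e])) hi gj
  have b2 := D.B_single_right_le hg (fun e => hv (by rw [← e, hdu])) hu gv
  have c1 := D.two_mul_d_mul_d_le (fun e => hj e.symm) hij
  have c2 := D.two_mul_d_mul_d_le (fun e => hv (by rw [← e, hdu])) huv
  have n1 : (D.d i : ℝ) * D.C i j ≤ 0 := mul_nonpos_of_nonneg_of_nonpos (D.d_pos_real i).le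
    (by exact_mod_cast D.offDiag i j (fun e => hj (by rw [e])))
  have n2 : (D.d u : ℝ) * D.C u v ≤ 0 := mul_nonpos_of_nonneg_of_nonpos (D.d_pos_real u).le
    (by exact_mod_cast D.offDiag u v (fun e => hv (by rw [← e, hdu])))
  have n3 : (D.d j : ℝ) * D.C j v ≤ 0 := mul_nonpos_of_nonneg_of_nonpos (D.d_pos_real j).le
    (by exact_mod_cast D.offDiag j v (Ne.symm hvj))
  set s := D.B g (Pi.single j 1) with hs'
  set t := D.B g (Pi.single v 1) with ht'
  rw [hdu] at c2 b2 n2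
  have e1 : 2 * (D.d i : ℝ) * D.d j ≤ s ^ 2 := c1.trans (by nlinarith)
  have e2 : 2 * (D.d i : ℝ) * D.d v ≤ t ^ 2 := c2.trans (by nlinarith)
  have pj := D.d_pos_real j
  have pv := D.d_pos_real v
  -- Remove from `g` its projections on `α_j` and `α_v`. Each removal costs at least `d_i`, and the
  -- cross term is nonpositive; as `B(g, g) ≤ 2 d_i`, the norm of `x` cannot be positive. But `x` is
  -- nonzero, since its coefficient at `i` is still that of `g`.
  let x : I → ℝ := g + (-s / (2 * D.d j)) • Pi.single j 1 + (-t / (2 * D.d v)) • Pi.single v 1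
  have hx : x ≠ 0 := by
    intro h
    have := congrFun h i
    have hij' : i ≠ j := fun e => hj (by rw [e])
    have hiv' : i ≠ v := fun e => hv (by rw [e])
    simp [x, hij', hiv'] at this
    linarith
  have hpos := D.B_pos hx
  have hval : D.B x x = D.B g g - s ^ 2 / (2 * D.d j) - t ^ 2 / (2 * D.d v) +
      2 * ((s / (2 * D.d j)) * (t / (2 * D.d v))) * (D.d j * D.C j v) := by
    simp only [x, B_add_left, B_add_right, B_smul_left, B_smul_right]
    rw [D.B_comm (Pi.single j 1) g, D.B_comm (Pi.single v 1) g,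
      D.B_comm (Pi.single v 1) (Pi.single j 1), B_single_self, B_single_self, B_single_single,
      ← hs', ← ht']
    field_simp
    ring
  have f1 : (D.d i : ℝ) ≤ s ^ 2 / (2 * D.d j) := by rw [le_div_iff₀ (by linarith)]; linarith
  have f2 : (D.d i : ℝ) ≤ t ^ 2 / (2 * D.d v) := by rw [le_div_iff₀ (by linarith)]; linarith
  have f3 : 0 ≤ (s / (2 * D.d j)) * (t / (2 * D.d v)) :=
    mul_nonneg_of_nonpos_of_nonpos (div_nonpos_of_nonpos_of_nonneg (by linarith) (by linarith))
      (div_nonpos_of_nonpos_of_nonneg (by linarith) (by linarith))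
  have f4 := mul_nonpos_of_nonneg_of_nonpos (mul_nonneg zero_le_two f3) n3
  linarith

/-- Next to a multiple bond, there are only two lengths of simple roots. -/
theorem d_eq_or_eq {i j : I} (hd : D.d i ≠ D.d j) (hC : D.C i j ≠ 0) (u : I) :
    D.d u = D.d i ∨ D.d u = D.d j := by
  have hC' : D.C j i ≠ 0 := fun h => hC (D.C_eq_zero_symm h)
  have hL : ∀ i u, D.Linked i u → D.d u = D.d i := by
    rintro i u ⟨g, -, hs, -, hu, -⟩
    exact hs u (by linarith)
  -- `S` is closed under adjacency: a neighbour of the same length is again linked, and by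
  -- `eq_of_linked` one of another length must be `j` or `i`.
  let S : Set I := {u | D.Linked i u ∨ D.Linked j u}
  have hS : Sᶜ = ∅ := by
    by_contra hne
    obtain ⟨a, ha, b, hb, hab⟩ := D.indec S ⟨i, Or.inl (D.linked_refl i)⟩
      (Set.nonempty_iff_ne_empty.mpr hne)
    rcases ha with ha | ha
    · by_cases hdb : D.d b = D.d i
      · exact hb (Or.inl (D.linked_step ha hdb hab))
      · rw [D.eq_of_linked ha hd.symm hdb hC hab] at hb
        exact hb (Or.inr (D.linked_refl j))
    · by_cases hdb : D.d b = D.d j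
      · exact hb (Or.inr (D.linked_step ha hdb hab))
      · rw [D.eq_of_linked ha hd hdb hC' hab] at hb
        exact hb (Or.inl (D.linked_refl i))
  have hu : u ∈ S := by
    by_contra h
    exact (Set.ext_iff.mp hS u).mp h
  exact hu.imp (hL i u) (hL j u)

/-- A multiple bond joins a root of squared length `2` to a longer one. -/
theorem bond_cases {i j : I} (hij : i ≠ j) :
    (D.C i j = D.C j i ∧ (D.C i j = 0 ∨ D.d i = D.d j)) ∨
      (D.C i j = -1 ∧ D.d j = 1 ∧ (D.d i : ℤ) = -D.C j i) ∨
      (D.C j i = -1 ∧ D.d i = 1 ∧ (D.d j : ℤ) = -D.C i j) := by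
  by_cases hC : D.C i j = 0
  · exact Or.inl ⟨by rw [hC, D.C_eq_zero_symm hC], Or.inl hC⟩
  have hs := D.symm i j
  by_cases hd : D.d i = D.d j
  · refine Or.inl ⟨?_, Or.inr hd⟩
    rw [hd] at hs
    exact mul_left_cancel₀ (Int.natCast_ne_zero.mpr (D.d_pos j).ne') hs
  right
  have h1 := D.C_le_neg_one hij hC
  have h2 := D.C_le_neg_one hij.symm fun h' => hC (D.C_eq_zero_symm h')
  have h3 := D.C_mul_C_lt hij
  -- With only two lengths, one dividing the other, the smaller divides every `d u` and hence their
  -- gcd.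
  have hone : ∀ a b : I, (∀ u, D.d u = D.d a ∨ D.d u = D.d b) → D.d b ∣ D.d a → D.d b = 1 := by
    intro a b hab hdvd
    have : D.d b ∣ Finset.univ.gcd D.d := Finset.dvd_gcd fun u _ => by
      rcases hab u with h | h
      · rwa [h]
      · rw [h]
    rw [D.d_gcd] at this
    exact Nat.dvd_one.mp this
  have hor : D.C i j = -1 ∨ D.C j i = -1 := by
    by_contra! h
    have := lt_of_le_of_ne h1 h.1
    have := lt_of_le_of_ne h2 h.2
    nlinarith
  rcases hor with h | h
  · left
    have e : (D.d i : ℤ) = D.d j * -D.C j i := by rw [h] at hs; linarith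
    have hj : D.d j = 1 := hone i j (D.d_eq_or_eq hd hC) (Int.natCast_dvd_natCast.mp ⟨_, e⟩)
    refine ⟨h, hj, ?_⟩
    rw [e, hj]
    simp
  · right
    have e : (D.d j : ℤ) = D.d i * -D.C i j := by rw [h] at hs; linarith
    have hi : D.d i = 1 := hone j i (fun u => (D.d_eq_or_eq hd hC u).symm)
      (Int.natCast_dvd_natCast.mp ⟨_, e⟩)
    refine ⟨h, hi, ?_⟩
    rw [e, hi]
    simp

end CartanDatum

theorem qint_neg (z : ℂ) (n : ℤ) : qint z (-n) = -qint z n := by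
  simp only [qint, neg_neg, ← neg_div, neg_sub]

theorem qint_zero (z : ℂ) : qint z 0 = 0 := by simp [qint]

/-- The matrix `([d_i]_z [C_{ij}]_z)` is symmetric. -/
theorem qint_d_mul_qint_C_symm {I : Type*} [Fintype I] [DecidableEq I] (D : CartanDatum I) (z : ℂ)
    {i j : I} (hij : i ≠ j) :
    qint z (D.d i) * qint z (D.C i j) = qint z (D.d j) * qint z (D.C j i) := by
  rcases D.bond_cases hij with ⟨h, h0 | h0⟩ | ⟨h1, h2, h3⟩ | ⟨h1, h2, h3⟩
  · rw [← h, h0, qint_zero, mul_zero, mul_zero]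
  · rw [h, h0]
  · rw [h1, h2, h3, qint_neg, qint_neg, Nat.cast_one]
    ring
  · rw [h1, h2, h3, qint_neg, qint_neg, Nat.cast_one]
    ring

/-! ### Exponentials and logarithms of power series -/

open PowerSeries in
-- The equation `Y' = uY` computes each coefficient from the earlier ones. The identities for `expS`
-- below follow from this uniqueness.
theorem eq_of_derivative_eq_mul {u Y Z : ℂ⟦X⟧} (hY : d⁄dX ℂ Y = u * Y) (hZ : d⁄dX ℂ Z = u * Z)
    (h0 : constantCoeff Y = constantCoeff Z) : Y = Z := by
  ext n
  induction n using Nat.strong_induction_on with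
  | _ n ih =>
    rcases n with _ | n
    · simpa using h0
    · have h : coeff n (d⁄dX ℂ Y) = coeff n (d⁄dX ℂ Z) := by
        rw [hY, hZ, coeff_mul, coeff_mul]
        refine Finset.sum_congr rfl fun p hp => ?_
        rw [ih p.2 (by have := Finset.HasAntidiagonal.mem_antidiagonal.mp hp; omega)]
      rw [coeff_derivative, coeff_derivative] at h
      exact mul_right_cancel₀ (Nat.cast_add_one_ne_zero n) h

/-- The exponential of a power series without constant term. -/
def expS (f : ℂ⟦X⟧) : ℂ⟦X⟧ := (PowerSeries.exp ℂ).subst f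

section expS

open PowerSeries

variable {f g : ℂ⟦X⟧}

theorem constantCoeff_expS (hf : constantCoeff f = 0) : constantCoeff (expS f) = 1 := by
  have h := constantCoeff_subst_eq_zero hf (PowerSeries.exp ℂ - 1) (by simp)
  rw [subst_sub (HasSubst.of_constantCoeff_zero' hf)] at h
  have h1 : (1 : ℂ⟦X⟧).subst f = (1 : ℂ⟦X⟧) := by
    rw [← coe_substAlgHom (HasSubst.of_constantCoeff_zero' hf), map_one]
  rw [h1, map_sub] at h
  have h2 : MvPowerSeries.constantCoeff (1 : ℂ⟦X⟧) = 1 := map_one _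
  rw [h2] at h
  exact sub_eq_zero.mp h

theorem derivative_expS (hf : constantCoeff f = 0) :
    d⁄dX ℂ (expS f) = d⁄dX ℂ f * expS f := by
  rw [expS, derivative_subst (HasSubst.of_constantCoeff_zero' hf), derivative_exp, mul_comm]

theorem expS_add (hf : constantCoeff f = 0) (hg : constantCoeff g = 0) :
    expS (f + g) = expS f * expS g := by
  have hfg : constantCoeff (f + g) = 0 := by rw [map_add, hf, hg, add_zero]
  refine eq_of_derivative_eq_mul (derivative_expS hfg) ?_ ?_
  · rw [Derivation.leibniz, derivative_expS hf, derivative_expS hg, map_add]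
    simp only [smul_eq_mul]
    ring
  · rw [map_mul, constantCoeff_expS hfg, constantCoeff_expS hf, constantCoeff_expS hg, mul_one]

theorem expS_zero : expS 0 = 1 := by
  refine eq_of_derivative_eq_mul (derivative_expS (by simp)) ?_ ?_
  · simp
  · rw [constantCoeff_expS (by simp), map_one]

/-- The logarithmic derivative of `expS f` is `f'`. -/
theorem expS_injective (hf : constantCoeff f = 0) (hg : constantCoeff g = 0)
    (h : expS f = expS g) : f = g := by
  refine derivative.ext ?_ (by rw [hf, hg])
  have hne : expS g ≠ 0 := fun h0 => by
    have := constantCoeff_expS hg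
    rw [h0, map_zero] at this
    exact zero_ne_one this
  have h1 := derivative_expS hf
  rw [h, derivative_expS hg] at h1
  exact (mul_right_cancel₀ hne h1).symm

/-- The expansion of `-log (1 - b z)`. -/
def logGeom (b : ℂ) : ℂ⟦X⟧ := PowerSeries.mk fun n => b ^ n / n

/-- The coefficient at `n = 0` is `b ^ 0 / 0`, which is `0` by the convention for division. -/
theorem constantCoeff_logGeom (b : ℂ) : constantCoeff (logGeom b) = 0 := by
  rw [← coeff_zero_eq_constantCoeff_apply, logGeom, coeff_mk]
  simp

theorem expS_neg_logGeom (b : ℂ) : expS (-logGeom b) = 1 - C b * X := by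
  have h0 : constantCoeff (-logGeom b) = 0 := by rw [map_neg, constantCoeff_logGeom, neg_zero]
  refine eq_of_derivative_eq_mul (derivative_expS h0) ?_ ?_
  · have hd : d⁄dX ℂ (-logGeom b) = PowerSeries.mk fun n => -(b ^ (n + 1)) := by
      ext n
      rw [coeff_derivative, map_neg, logGeom, coeff_mk, coeff_mk]
      have : (n : ℂ) + 1 ≠ 0 := Nat.cast_add_one_ne_zero n
      push_cast
      field_simp
    rw [hd]
    ext n
    rw [coeff_derivative, mul_sub, mul_one, mul_left_comm, map_sub, map_sub, coeff_C_mul,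
      coeff_C_mul]
    rcases n with _ | n
    · simp [coeff_one]
    · rw [coeff_succ_mul_X, coeff_mk, coeff_mk, coeff_one, coeff_X]
      simp
      ring
  · rw [constantCoeff_expS h0]
    simp

theorem expS_logGeom_mul (b : ℂ) : expS (logGeom b) * (1 - C b * X) = 1 := by
  rw [← expS_neg_logGeom, ← expS_add (constantCoeff_logGeom b)
    (by rw [map_neg, constantCoeff_logGeom, neg_zero]), add_neg_cancel, expS_zero]

/-- As `f` has no constant term, each coefficient of the substitution is a finite sum, which `χ`
respects. -/
theorem map_exp_subst {A : Type*} [CommRing A] [Algebra ℂ A] (χ : A →ₐ[ℂ] ℂ) {f : A⟦X⟧}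
    (hf : constantCoeff f = 0) :
    PowerSeries.map (χ : A →+* ℂ) ((PowerSeries.exp ℂ).subst f) =
      expS (PowerSeries.map (χ : A →+* ℂ) f) := by
  have hs := HasSubst.of_constantCoeff_zero' hf
  have hf' : constantCoeff (PowerSeries.map (χ : A →+* ℂ) f) = 0 := by
    rw [← coeff_zero_eq_constantCoeff_apply, coeff_map, coeff_zero_eq_constantCoeff_apply, hf,
      map_zero]
  ext n
  rw [coeff_map, expS, coeff_subst' hs, coeff_subst' (HasSubst.of_constantCoeff_zero' hf')]
  change (χ : A →+* ℂ).toAddMonoidHom _ = _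
  rw [AddMonoidHom.map_finsum _ (coeff_subst_finite' hs _ _)]
  refine finsum_congr fun d => ?_
  rw [← map_pow, coeff_map]
  exact map_smul χ _ _

end expS

/-! ### Expansions of a rational function at zero and at infinity -/

section Balanced

open Polynomial

/-- The first series is the expansion at `0`, and the second one the expansion at `∞`, of one
rational function. -/
def IsBalanced (F G : ℂ⟦X⟧) : Prop :=
  ∃ (N : ℕ) (P Q : ℂ[X]), P.natDegree ≤ N ∧ Q.natDegree ≤ N ∧ P ≠ 0 ∧
    (P : ℂ⟦X⟧) * G = Q ∧ (P.reflect N : ℂ⟦X⟧) * F = (Q.reflect N : ℂ[X])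

theorem IsBalanced.mul {F G F' G' : ℂ⟦X⟧} (h : IsBalanced F G) (h' : IsBalanced F' G') :
    IsBalanced (F * F') (G * G') := by
  obtain ⟨N, P, Q, hP, hQ, h0, h1, h2⟩ := h
  obtain ⟨N', P', Q', hP', hQ', h0', h1', h2'⟩ := h'
  refine ⟨N + N', P * P', Q * Q', natDegree_mul_le_of_le hP hP', natDegree_mul_le_of_le hQ hQ',
    mul_ne_zero h0 h0', ?_, ?_⟩
  · rw [coe_mul, coe_mul, ← h1, ← h1']
    ring
  · rw [reflect_mul _ _ hP hP', reflect_mul _ _ hQ hQ', coe_mul, coe_mul, ← h2, ← h2']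
    ring

theorem IsBalanced.inv {F G F' G' : ℂ⟦X⟧} (h : IsBalanced F G) (hF : F * F' = 1)
    (hG : G * G' = 1) : IsBalanced F' G' := by
  obtain ⟨N, P, Q, hP, hQ, h0, h1, h2⟩ := h
  refine ⟨N, Q, P, hQ, hP, ?_, ?_, ?_⟩
  · rintro rfl
    have hG0 : G ≠ 0 := left_ne_zero_of_mul_eq_one hG
    rw [coe_zero] at h1
    rcases mul_eq_zero.mp h1 with h | h
    · exact h0 (by exact_mod_cast h)
    · exact hG0 h
  · rw [← h1, mul_assoc, hG, mul_one]
  · rw [← h2, mul_assoc, hF, mul_one]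

/-- The expansion `F` determines the fraction `Q / P`: cross-multiplying the reflected equations
eliminates `F`, and reflecting back gives `P' Q = P Q'`. -/
theorem IsBalanced.eq {F G G' : ℂ⟦X⟧} (h : IsBalanced F G) (h' : IsBalanced F G') : G = G' := by
  obtain ⟨N, P, Q, hP, hQ, h0, h1, h2⟩ := h
  obtain ⟨N', P', Q', hP', hQ', h0', h1', h2'⟩ := h'
  have key : P' * Q = P * Q' := by
    have e : reflect (N' + N) (P' * Q) = reflect (N' + N) (P * Q') := by
      rw [reflect_mul _ _ hP' hQ, add_comm N' N, reflect_mul _ _ hP hQ']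
      have : ((reflect N' P' * reflect N Q : ℂ[X]) : ℂ⟦X⟧) = (reflect N P * reflect N' Q' : ℂ[X]) := by
        rw [coe_mul, coe_mul, ← h2, ← h2']
        ring
      exact_mod_cast this
    have := congrArg (reflect (N' + N)) e
    rwa [reflect_reflect, reflect_reflect] at this
  have hne : (P : ℂ⟦X⟧) * (P' : ℂ⟦X⟧) ≠ 0 :=
    mul_ne_zero (by exact_mod_cast h0) (by exact_mod_cast h0')
  refine mul_left_cancel₀ hne ?_
  calc (P : ℂ⟦X⟧) * P' * G = P' * (P * G) := by ring
    _ = (P' * Q : ℂ[X]) := by rw [h1, coe_mul]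
    _ = (P * Q' : ℂ[X]) := by rw [key]
    _ = P * (P' * G') := by rw [h1', coe_mul]
    _ = P * P' * G' := by ring

theorem coeff_coe_mul {P : ℂ[X]} {N : ℕ} (hP : P.natDegree ≤ N) (G : ℂ⟦X⟧) (m : ℕ) :
    PowerSeries.coeff m ((P : ℂ⟦X⟧) * G) = ∑ k ∈ Finset.range (N + 1),
      P.coeff k * (if k ≤ m then PowerSeries.coeff (m - k) G else 0) := by
  conv_lhs => rw [P.as_sum_range' (N + 1) (Nat.lt_succ_of_le hP)]
  have : ((∑ k ∈ Finset.range (N + 1), monomial k (P.coeff k) : ℂ[X]) : ℂ⟦X⟧) =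
      ∑ k ∈ Finset.range (N + 1), ((monomial k (P.coeff k) : ℂ[X]) : ℂ⟦X⟧) := by
    simp only [← coeToPowerSeries.ringHom_apply, map_sum]
  rw [this, Finset.sum_mul, map_sum]
  refine Finset.sum_congr rfl fun k _ => ?_
  rw [← C_mul_X_pow_eq_monomial, coe_mul, coe_C, coe_pow, coe_X, mul_assoc,
    PowerSeries.coeff_C_mul, PowerSeries.coeff_X_pow_mul']

/-- Two power series whose difference, as a series infinite in both directions, satisfies a linear
recurrence are expansions of one rational function. -/
theorem isBalanced_of_recurrence {F G : ℂ⟦X⟧} {P : ℂ[X]} (hP : P ≠ 0)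
    (h : ∀ n : ℤ, ∑ k ∈ Finset.range (P.natDegree + 1), P.coeff k *
      ((if 0 ≤ n + k then PowerSeries.coeff (n + k).natAbs F else 0) -
        (if n + k ≤ 0 then PowerSeries.coeff (n + k).natAbs G else 0)) = 0) : IsBalanced F G := by
  set N := P.natDegree with hN
  -- `Q` is `P G` cut off at degree `N`. The recurrence at `n = -m` with `m > N` involves no
  -- coefficient of `F`, so nothing is lost; at `n = m - N` it matches coefficient `m` of the
  -- reflected `P` times `F` with coefficient `N - m` of `P G`.
  let Q : ℂ[X] := ∑ m ∈ Finset.range (N + 1), monomial m (PowerSeries.coeff m ((P : ℂ⟦X⟧) * G))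
  have hQc : ∀ m, Q.coeff m = if m ≤ N then PowerSeries.coeff m ((P : ℂ⟦X⟧) * G) else 0 := by
    intro m
    simp only [Q, finsetSum_coeff, coeff_monomial, Finset.sum_ite_eq', Finset.mem_range,
      Nat.lt_succ_iff]
  have hQd : Q.natDegree ≤ N := natDegree_le_iff_coeff_eq_zero.mpr fun m hm => by
    rw [hQc, if_neg (not_le.mpr hm)]
  have hsplit : ∀ n : ℤ, ∑ k ∈ Finset.range (N + 1), P.coeff k *
      (if 0 ≤ n + k then PowerSeries.coeff (n + k).natAbs F else 0) =
      ∑ k ∈ Finset.range (N + 1), P.coeff k *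
        (if n + k ≤ 0 then PowerSeries.coeff (n + k).natAbs G else 0) := by
    intro n
    have := h n
    simp only [mul_sub, Finset.sum_sub_distrib] at this
    exact sub_eq_zero.mp this
  have hG : ∀ m : ℕ, PowerSeries.coeff m ((P : ℂ⟦X⟧) * G) =
      ∑ k ∈ Finset.range (N + 1), P.coeff k *
        (if -(m : ℤ) + k ≤ 0 then PowerSeries.coeff (-(m : ℤ) + k).natAbs G else 0) := by
    intro m
    rw [coeff_coe_mul le_rfl]
    refine Finset.sum_congr rfl fun k _ => ?_
    by_cases hk : k ≤ m
    · rw [if_pos hk, if_pos (by omega)]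
      congr 3
      omega
    · rw [if_neg hk, if_neg (by omega)]
  have hrev : ∀ m, m ≤ N → revAt N m = N - m := fun m hm => revAt_le hm
  have hRd : (P.reflect N).natDegree ≤ N := natDegree_le_iff_coeff_eq_zero.mpr fun m hm => by
    rw [coeff_reflect, revAt_eq_self_of_lt hm]
    exact coeff_eq_zero_of_natDegree_lt hm
  have hF : ∀ m : ℕ, PowerSeries.coeff m ((P.reflect N : ℂ⟦X⟧) * F) =
      ∑ k ∈ Finset.range (N + 1), P.coeff k *
        (if 0 ≤ ((m : ℤ) - N) + k then PowerSeries.coeff (((m : ℤ) - N) + k).natAbs F else 0) := by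
    intro m
    rw [coeff_coe_mul hRd, ← Finset.sum_range_reflect]
    refine Finset.sum_congr rfl fun k hk => ?_
    have hk' : k ≤ N := Nat.lt_succ_iff.mp (Finset.mem_range.mp hk)
    rw [coeff_reflect, hrev _ (by omega), show N - (N + 1 - 1 - k) = k by omega]
    by_cases hkm : N + 1 - 1 - k ≤ m
    · rw [if_pos hkm, if_pos (by omega)]
      congr 3
      omega
    · rw [if_neg hkm, if_neg (by omega)]
  refine ⟨N, P, Q, le_rfl, hQd, hP, ?_, ?_⟩
  · ext m
    rw [coeff_coe, hQc]
    split_ifs with hm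
    · rfl
    · rw [hG, ← hsplit]
      refine Finset.sum_eq_zero fun k hk => ?_
      have := Finset.mem_range.mp hk
      rw [if_neg (by omega), mul_zero]
  · ext m
    rw [coeff_coe, coeff_reflect, hQc, hF, hsplit]
    by_cases hm : m ≤ N
    · rw [hrev m hm, if_pos (by omega), hG, Nat.cast_sub hm, neg_sub]
    · rw [revAt_eq_self_of_lt (not_le.mp hm), if_neg hm]
      refine Finset.sum_eq_zero fun k _ => ?_
      rw [if_neg (by omega), mul_zero]

end Balanced

/-! ### Power sums and weights of monomials -/

section Monomials

variable {I : Type*}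

theorem mon_induction {p : Mon I → Prop} (one : p 1) (mul : ∀ m m', p m → p m' → p (m * m'))
    (inv : ∀ m, p m → p m⁻¹) (gen : ∀ i a, p (Y i a)) (m : Mon I) : p m := by
  have hpow : ∀ (i : I) (a : ℂˣ) (n : ℕ), p (Y i a ^ n) := by
    intro i a n
    induction n with
    | zero => rwa [pow_zero]
    | succ n ih => rw [pow_succ]; exact mul _ _ ih (gen i a)
  have hz : ∀ (i : I) (a : ℂˣ) (n : ℤ), p (Y i a ^ n) := by
    intro i a n
    rcases n with n | n
    · rw [Int.ofNat_eq_natCast, zpow_natCast]; exact hpow i a n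
    · rw [zpow_negSucc]; exact inv _ (hpow i a _)
  suffices h : ∀ f : I × ℂˣ →₀ ℤ, p (Multiplicative.ofAdd f) from h m.toAdd
  intro f
  induction f using Finsupp.induction_linear with
  | zero => exact one
  | add f g hf hg => exact mul _ _ hf hg
  | single x n =>
    have : Multiplicative.ofAdd (Finsupp.single x n) = Y x.1 x.2 ^ n := by
      rw [Y, ← ofAdd_zsmul]
      simp
    rw [this]
    exact hz _ _ _

variable [DecidableEq I]

/-- The sum `∑_a u_{i,a} a^r`. -/
def powerSum (i : I) (r : ℤ) (m : Mon I) : ℂ :=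
  m.toAdd.sum fun x u => if x.1 = i then (u : ℂ) * (x.2 : ℂ) ^ r else 0

theorem powerSum_mul (i : I) (r : ℤ) (m m' : Mon I) :
    powerSum i r (m * m') = powerSum i r m + powerSum i r m' := by
  refine Finsupp.sum_add_index' (fun p => ?_) (fun p a b => ?_)
  · split_ifs <;> simp
  · split_ifs <;> simp [add_mul]

theorem powerSum_one (i : I) (r : ℤ) : powerSum i r 1 = 0 := Finsupp.sum_zero_index

theorem powerSum_inv (i : I) (r : ℤ) (m : Mon I) : powerSum i r m⁻¹ = -powerSum i r m := by
  rw [eq_neg_iff_add_eq_zero, ← powerSum_mul, inv_mul_cancel, powerSum_one]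

theorem powerSum_prod {κ : Type*} (i : I) (r : ℤ) (s : Finset κ) (f : κ → Mon I) :
    powerSum i r (∏ j ∈ s, f j) = ∑ j ∈ s, powerSum i r (f j) := by
  classical
  induction s using Finset.induction_on with
  | empty => simp [powerSum_one]
  | insert a s ha ih => rw [Finset.prod_insert ha, Finset.sum_insert ha, powerSum_mul, ih]

theorem powerSum_Y (i : I) (r : ℤ) (j : I) (a : ℂˣ) :
    powerSum i r (Y j a) = if j = i then (a : ℂ) ^ r else 0 := by
  rw [powerSum, Y, toAdd_ofAdd, Finsupp.sum_single_index] <;> simp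

/-- Lets the weight of `A_{i,a}` be computed like its power sums. -/
theorem intCast_wt (m : Mon I) (i : I) : (wt m i : ℂ) = powerSum i 0 m := by
  simp only [wt, powerSum, Finsupp.sum, Int.cast_sum, zpow_zero, mul_one]
  exact Finset.sum_congr rfl fun x _ => by split_ifs <;> simp

theorem wt_one : wt (1 : Mon I) = 0 := by
  funext i
  exact Finsupp.sum_zero_index

theorem wt_inv (m : Mon I) : wt m⁻¹ = -wt m := by
  rw [eq_neg_iff_add_eq_zero, ← wt_mul, inv_mul_cancel, wt_one]

theorem wt_Y (i : I) (a : ℂˣ) : wt (Y i a) = Pi.single i 1 := by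
  funext j
  rw [wt, Y, toAdd_ofAdd, Finsupp.sum_single_index (by simp), Pi.single_apply]
  simp [eq_comm]

end Monomials

/-! ### Nonvanishing away from roots of unity, and the form on the weight lattice -/

theorem zpow_sub_zpow_neg_ne_zero {q : ℂˣ} (hq : ∀ n : ℕ, 0 < n → q ^ n ≠ 1) {r : ℤ} (hr : r ≠ 0) :
    (q : ℂ) ^ r - (q : ℂ) ^ (-r) ≠ 0 := by
  intro h
  have h1 : (q : ℂ) ^ r * (q : ℂ) ^ r = 1 := by
    nth_rewrite 1 [sub_eq_zero.mp h]
    rw [← zpow_add₀ q.ne_zero, neg_add_cancel, zpow_zero]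
  have h2 : q ^ (r + r) = 1 := by
    ext
    rw [Units.val_zpow_eq_zpow_val, zpow_add₀ q.ne_zero, h1, Units.val_one]
  have h3 : q ^ (r + r).natAbs = 1 := by
    rcases Int.natAbs_eq (r + r) with h | h
    · rw [← zpow_natCast, ← h, h2]
    · rw [← zpow_natCast, ← inv_inj, ← zpow_neg, ← h, h2, inv_one]
  exact hq _ (by omega) h3

theorem sub_inv_ne_zero {q : ℂˣ} (hq : ∀ n : ℕ, 0 < n → q ^ n ≠ 1) :
    (q : ℂ) - (q : ℂ)⁻¹ ≠ 0 := by
  simpa using zpow_sub_zpow_neg_ne_zero hq one_ne_zero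

theorem algHom_ext_kwt_hgen {I : Type*} {χ χ' : CartanAlg I →ₐ[ℂ] ℂ} (hk : ∀ lam, χ (kwt lam) = χ' (kwt lam))
    (hh : ∀ i r, χ (hgen i r) = χ' (hgen i r)) : χ = χ' := by
  refine MvPolynomial.algHom_ext' ?_ fun p => hh p.1 p.2
  exact AddMonoidAlgebra.algHom_ext (fun lam => hk lam) (Subsingleton.elim _ _)

section Datum

variable {I : Type*} [Fintype I] [DecidableEq I] (D : CartanDatum I) {q : ℂˣ} (hbar : ℂ)

theorem qi_not_root_of_unity (hq : ∀ n : ℕ, 0 < n → q ^ n ≠ 1) (i : I) :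
    ∀ n : ℕ, 0 < n → qi D q i ^ n ≠ 1 := by
  intro n hn
  rw [qi, ← pow_mul]
  exact hq _ (Nat.mul_pos (D.d_pos i) hn)

theorem qi_zpow (i : I) (r : ℤ) : (qi D q i : ℂ) ^ r = ((q : ℂ) ^ r) ^ D.d i := by
  rw [qi, Units.val_pow_eq_pow_val, ← zpow_natCast, ← zpow_natCast, ← zpow_mul, ← zpow_mul,
    mul_comm]

/-- The positive definite matrix `(d_i C_{ij})` has determinant `∏ d_i` times that of `C`. -/
theorem C_det_ne_zero : (D.C.map (Int.cast : ℤ → ℚ)).det ≠ 0 := by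
  intro h
  have h1 : D.C.det = 0 := by
    have := Int.cast_det (R := ℚ) D.C
    rw [h] at this
    exact_mod_cast this
  have h2 := D.posDef.det_pos
  have h3 : (Matrix.of fun i j => (D.d i : ℝ) * (D.C i j : ℝ)) =
      Matrix.of fun i j => (D.d i : ℝ) * (D.C.map (Int.cast : ℤ → ℝ)) i j := rfl
  rw [h3, Matrix.det_mul_column, ← Int.cast_det, h1] at h2
  simp at h2

theorem form_add_right (lam mu mu' : I → ℤ) :
    form D lam (mu + mu') = form D lam mu + form D lam mu' := by
  simp [form, add_mul, mul_add, Finset.sum_add_distrib]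

theorem form_smul_left (c : ℤ) (lam mu : I → ℤ) : form D (c • lam) mu = c * form D lam mu := by
  simp [form, Finset.mul_sum, mul_assoc]

theorem form_smul_right (c : ℤ) (lam mu : I → ℤ) : form D lam (c • mu) = c * form D lam mu := by
  simp only [form, Finset.mul_sum, Pi.smul_apply, smul_eq_mul, Int.cast_mul]
  refine Finset.sum_congr rfl fun i _ => Finset.sum_congr rfl fun j _ => by ring

/-- Symmetrizability turns the column of `C` defining `α_i` into a row, which then cancels against
`C⁻¹`. -/
theorem form_simpleRoot_left (i : I) (mu : I → ℤ) :
    form D (simpleRoot D i) mu = D.d i * mu i := by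
  set M := D.C.map (Int.cast : ℤ → ℚ) with hM
  have hinv : ∀ j, ∑ l, M i l * M⁻¹ l j = if i = j then 1 else 0 := by
    intro j
    have := congrFun (congrFun (Matrix.mul_nonsing_inv M
      (isUnit_iff_ne_zero.mpr (C_det_ne_zero D))) i) j
    simpa [Matrix.mul_apply, Matrix.one_apply] using this
  have hs : ∀ l, (D.d l : ℚ) * D.C l i = D.d i * M i l := fun l => by
    have := D.symm l i
    simp only [hM, Matrix.map_apply]
    exact_mod_cast this
  calc form D (simpleRoot D i) mu
      = ∑ j, ∑ l, (D.C l i : ℚ) * mu j * (D.d l * M⁻¹ l j) := by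
        rw [form, Finset.sum_comm]
        rfl
    _ = ∑ j, D.d i * mu j * ∑ l, M i l * M⁻¹ l j := by
        refine Finset.sum_congr rfl fun j _ => ?_
        rw [Finset.mul_sum]
        refine Finset.sum_congr rfl fun l _ => ?_
        linear_combination (mu j * M⁻¹ l j : ℚ) * hs l
    _ = D.d i * mu i := by simp [hinv]

theorem form_simpleRoot_right (i : I) (lam : I → ℤ) :
    form D lam (simpleRoot D i) = D.d i * lam i := by
  set M := D.C.map (Int.cast : ℤ → ℚ) with hM
  have hinv : ∀ l, ∑ j, M⁻¹ l j * M j i = if l = i then 1 else 0 := by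
    intro l
    have := congrFun (congrFun (Matrix.nonsing_inv_mul M
      (isUnit_iff_ne_zero.mpr (C_det_ne_zero D))) l) i
    simpa [Matrix.mul_apply, Matrix.one_apply] using this
  calc form D lam (simpleRoot D i)
      = ∑ l, D.d l * lam l * ∑ j, M⁻¹ l j * M j i := by
        refine Finset.sum_congr rfl fun l _ => ?_
        rw [Finset.mul_sum]
        refine Finset.sum_congr rfl fun j _ => ?_
        simp only [hM, Matrix.map_apply, simpleRoot]
        ring
    _ = D.d i * lam i := by simp [hinv]

theorem form_simpleRefl (i : I) (lam mu : I → ℤ) :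
    form D (simpleRefl D i lam) (simpleRefl D i mu) = form D lam mu := by
  have h : ∀ nu : I → ℤ, simpleRefl D i nu = nu + (-nu i) • simpleRoot D i := fun nu => by
    rw [neg_smul, ← sub_eq_add_neg]
    rfl
  rw [h lam, h mu]
  simp only [form_add_left, form_add_right, form_smul_left, form_smul_right,
    form_simpleRoot_left, form_simpleRoot_right]
  simp only [Pi.add_apply, Pi.smul_apply, simpleRoot, D.diag, smul_eq_mul]
  push_cast
  ring

/-! ### The character -/

theorem qform_add_left (lam lam' mu : I → ℤ) :
    qform D hbar (lam + lam') mu = qform D hbar lam mu * qform D hbar lam' mu := by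
  rw [qform, form_add_left, Rat.cast_add, mul_add, Complex.exp_add]; rfl

theorem qform_add_right (lam mu mu' : I → ℤ) :
    qform D hbar lam (mu + mu') = qform D hbar lam mu * qform D hbar lam mu' := by
  rw [qform, form_add_right, Rat.cast_add, mul_add, Complex.exp_add]; rfl

theorem qform_zero_right (lam : I → ℤ) : qform D hbar lam 0 = 1 := by
  simp [qform, form]

theorem qform_simpleRoot (hexp : (q : ℂ) = Complex.exp hbar) (i : I) (mu : I → ℤ) :
    qform D hbar (simpleRoot D i) mu = (qi D q i : ℂ) ^ mu i := by
  rw [qform, form_simpleRoot_left, qi, Units.val_pow_eq_pow_val, hexp, ← Complex.exp_nat_mul,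
    ← Complex.exp_int_mul]
  push_cast
  congr 1
  ring

variable (q)

theorem character_kwt (m : Mon I) (lam : I → ℤ) :
    character D q hbar m (kwt lam) = qform D hbar lam (wt m) := by
  simp [character, kwt]
  rfl

theorem character_hgen (m : Mon I) (i : I) (r : {r : ℤ // r ≠ 0}) :
    character D q hbar m (hgen i r) =
      qint (qi D q i) r / ((r : ℤ) : ℂ) * powerSum i r m := by
  simp [character, hgen, powerSum]

variable {q}

/-! ### Invariance of the pairing -/

theorem qint_neg_one {z : ℂ} (hz : z - z⁻¹ ≠ 0) : qint z (-1) = -1 := by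
  rw [qint, div_eq_iff hz]
  simp

theorem qint_neg_two {z : ℂ} (hz0 : z ≠ 0) (hz : z - z⁻¹ ≠ 0) : qint z (-2) = -(z⁻¹ + z) := by
  rw [qint, div_eq_iff hz]
  simp only [neg_neg, zpow_neg]
  norm_cast
  field_simp
  ring

theorem qint_neg_three {z : ℂ} (hz0 : z ≠ 0) (hz : z - z⁻¹ ≠ 0) :
    qint z (-3) = -((z ^ 2)⁻¹ + 1 + z ^ 2) := by
  rw [qint, div_eq_iff hz]
  simp only [neg_neg, zpow_neg]
  norm_cast
  field_simp
  ring

/-- The spectral shifts in `A_{i,a}` are the exponents in the entries of column `i` of `C(z)`; off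
the diagonal these are `[-1]_z`, `[-2]_z`, `[-3]_z` or zero. -/
theorem powerSum_A (hq : ∀ n : ℕ, 0 < n → q ^ n ≠ 1) (i l : I) (a : ℂˣ) {r : ℤ} (hr : r ≠ 0) :
    powerSum l r (A D q i a) = (a : ℂ) ^ r * qCartan D ((q : ℂ) ^ r) l i := by
  have hz0 : (q : ℂ) ^ r ≠ 0 := zpow_ne_zero _ q.ne_zero
  have hz : (q : ℂ) ^ r - ((q : ℂ) ^ r)⁻¹ ≠ 0 := by
    rw [← zpow_neg]
    exact zpow_sub_zpow_neg_ne_zero hq hr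
  have hq2 : ((q : ℂ) ^ 2) ^ r = ((q : ℂ) ^ r) ^ 2 := by
    rw [← zpow_natCast, ← zpow_natCast, ← zpow_mul, ← zpow_mul, mul_comm]
  simp only [A, powerSum_mul, powerSum_inv, powerSum_prod, powerSum_Y, Finset.sum_add_distrib,
    Finset.sum_ite_eq', Finset.mem_filter, Finset.mem_univ, true_and, Units.val_mul,
    Units.val_inv_eq_inv_val, mul_zpow, inv_zpow, Units.val_pow_eq_pow_val, hq2, qi_zpow]
  rw [qCartan, Matrix.of_apply]
  by_cases hli : l = i
  · subst hli
    simp [D.diag]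
    ring
  · have h1 := D.neg_three_le_C hli
    have h2 := D.offDiag l i hli
    have h3 : D.C l i = 0 ∨ D.C l i = -1 ∨ D.C l i = -2 ∨ D.C l i = -3 := by omega
    have hil : ¬ i = l := fun h => hli h.symm
    rw [if_neg hli, if_neg hil, if_neg hil]
    rcases h3 with h | h | h | h
    · simp [h, qint_zero]
    · simp [h, qint_neg_one hz]
    · simp [h, qint_neg_two hz0 hz]
      ring
    · simp [h, qint_neg_three hz0 hz]
      ring

theorem wt_A (i : I) (a : ℂˣ) : wt (A D q i a) = simpleRoot D i := by
  funext l
  have : (wt (A D q i a) l : ℂ) = (simpleRoot D i l : ℂ) := by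
    rw [intCast_wt]
    simp only [A, powerSum_mul, powerSum_inv, powerSum_prod, powerSum_Y, Finset.sum_add_distrib,
      Finset.sum_ite_eq', Finset.mem_filter, Finset.mem_univ, true_and, zpow_zero, simpleRoot]
    by_cases hli : l = i
    · subst hli
      simp [D.diag]
      norm_num
    · have h1 := D.neg_three_le_C hli
      have h2 := D.offDiag l i hli
      have h3 : D.C l i = 0 ∨ D.C l i = -1 ∨ D.C l i = -2 ∨ D.C l i = -3 := by omega
      have hil : ¬ i = l := fun h => hli h.symm
      rcases h3 with h | h | h | h <;> simp [h, hil] <;> norm_num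
  exact_mod_cast this

theorem braidMon_Y (i j : I) (a : ℂˣ) : braidMon D q i (Y j a) =
    if j = i then Y i a * (A D q i (a * qi D q i))⁻¹ else Y j a :=
  monLift_Y _ _ _

theorem wt_braidMon (i : I) (m : Mon I) : wt (braidMon D q i m) = simpleRefl D i (wt m) := by
  induction m using mon_induction with
  | one => rw [map_one, wt_one, map_zero]
  | mul m m' h h' => rw [map_mul, wt_mul, wt_mul, map_add, h, h']
  | inv m h => rw [map_inv, wt_inv, wt_inv, map_neg, h]
  | gen j a =>
    rw [braidMon_Y, wt_Y]
    by_cases hj : j = i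
    · subst hj
      rw [if_pos rfl, wt_mul, wt_inv, wt_A, wt_Y]
      funext l
      simp [simpleRefl, sub_eq_add_neg]
    · rw [if_neg hj, wt_Y]
      funext l
      simp [simpleRefl, Ne.symm hj]

/-- Both sides are `(q^{r d_j} - q^{-r d_j}) / (q - q⁻¹)`. The right side has the factor `[d_j]_z`
at `z = q^r`, where the symmetry of `[d_i]_z [C_{ij}]_z` applies. -/
theorem qint_qi_mul (hq : ∀ n : ℕ, 0 < n → q ^ n ≠ 1) (j : I) {r : ℤ} (hr : r ≠ 0) :
    qint q (D.d j) * qint (qi D q j) r = qint q r * qint ((q : ℂ) ^ r) (D.d j) := by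
  have h1 := sub_inv_ne_zero hq
  have h2 := sub_inv_ne_zero (qi_not_root_of_unity D hq j)
  have h3 := zpow_sub_zpow_neg_ne_zero hq hr
  have e : (qi D q j : ℂ) = (q : ℂ) ^ D.d j := by rw [qi, Units.val_pow_eq_pow_val]
  simp only [qint]
  rw [← zpow_neg _ r]
  have e1 : ((q : ℂ) ^ r) ^ (D.d j : ℤ) = (qi D q j : ℂ) ^ r := by rw [qi_zpow, zpow_natCast]
  have e2 : ((q : ℂ) ^ r) ^ (-(D.d j : ℤ)) = (qi D q j : ℂ) ^ (-r) := by
    rw [zpow_neg, e1, zpow_neg]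
  have e3 : (q : ℂ) ^ (D.d j : ℤ) = qi D q j := by rw [zpow_natCast, e]
  have e4 : (q : ℂ) ^ (-(D.d j : ℤ)) = (qi D q j : ℂ)⁻¹ := by rw [zpow_neg, e3]
  rw [e1, e2, e3, e4, div_mul_div_comm, div_mul_div_comm, div_eq_div_iff (mul_ne_zero h1 h2)
    (mul_ne_zero h1 h3)]
  ring

theorem powerSum_braidMon (hq : ∀ n : ℕ, 0 < n → q ^ n ≠ 1) (i j : I) {r : ℤ} (hr : r ≠ 0)
    (m : Mon I) :
    powerSum j r (braidMon D q i m) = powerSum j r m -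
      (qi D q i : ℂ) ^ r * qCartan D ((q : ℂ) ^ r) j i * powerSum i r m := by
  induction m using mon_induction with
  | one => simp [powerSum_one]
  | mul m m' h h' => rw [map_mul, powerSum_mul, powerSum_mul, powerSum_mul, h, h']; ring
  | inv m h => rw [map_inv, powerSum_inv, powerSum_inv, powerSum_inv, h]; ring
  | gen k a =>
    rw [braidMon_Y]
    by_cases hk : k = i
    · subst hk
      rw [if_pos rfl, powerSum_mul, powerSum_inv, powerSum_A D hq _ _ _ hr, powerSum_Y k,
        if_pos rfl, Units.val_mul, mul_zpow]
      ring
    · rw [if_neg hk, powerSum_Y i, if_neg hk, mul_zero, sub_zero]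

theorem character_braid (hq : ∀ n : ℕ, 0 < n → q ^ n ≠ 1) (i : I) (m : Mon I) (a : CartanAlg I) :
    character D q hbar (braidMon D q i m) (braidCartan D q i a) = character D q hbar m a := by
  suffices h : (character D q hbar (braidMon D q i m)).comp (braidCartan D q i) =
      character D q hbar m from congrArg (fun χ => χ a) h
  refine algHom_ext_kwt_hgen (fun lam => ?_) fun j r => ?_
  · rw [AlgHom.comp_apply, braidCartan_kwt, character_kwt, character_kwt, wt_braidMon, qform,
      form_simpleRefl, qform]
  · have hr := r.2
    have hb : braidCartan D q i (hgen j r) = hgen j r - ((qi D q i : ℂ) ^ (-(r : ℤ)) *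
        qCartan D ((q : ℂ) ^ (r : ℤ)) i j * (qint q (D.d i) / qint q (D.d j))) • hgen i r := by
      simp [braidCartan, hgen]
    rw [AlgHom.comp_apply, hb, map_sub, map_smul, character_hgen, character_hgen, character_hgen,
      powerSum_braidMon D hq i j hr, powerSum_braidMon D hq i i hr, smul_eq_mul]
    set z := (q : ℂ) ^ (r : ℤ) with hz
    have hqi : (qi D q i : ℂ) ^ (r : ℤ) = z ^ D.d i := qi_zpow D i r
    have hqi' : (qi D q i : ℂ) ^ (-(r : ℤ)) = (z ^ D.d i)⁻¹ := by rw [zpow_neg, hqi]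
    have hz0 : z ^ D.d i ≠ 0 := pow_ne_zero _ (zpow_ne_zero _ q.ne_zero)
    have hii : qCartan D z i i = z ^ D.d i + (z ^ D.d i)⁻¹ := by simp [qCartan]
    have hdj := qint_ne_zero q hq (D.d j) (D.d_pos j)
    have hr' : ((r : ℤ) : ℂ) ≠ 0 := Int.cast_ne_zero.mpr hr
    have key : qint q (D.d j) * qint (qi D q j) r * qCartan D z j i =
        qint q (D.d i) * qint (qi D q i) r * qCartan D z i j := by
      by_cases hij : i = j
      · rw [hij]
      · rw [qint_qi_mul D hq j hr, qint_qi_mul D hq i hr, qCartan, Matrix.of_apply,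
          Matrix.of_apply, if_neg hij, if_neg (Ne.symm hij)]
        have := qint_d_mul_qint_C_symm D z hij
        rw [← hz]
        linear_combination (-(qint q r)) * this
    -- With `Z = q_i^r`, the power sum at `i` is multiplied by `1 - Z (Z + Z⁻¹) = -Z²`. The
    -- correction in `T_i(h_{j,r})` therefore contributes with a factor `Z`, and `key` cancels it
    -- against the correction in `T_i(m)`.
    rw [hqi, hqi', hii]
    field_simp
    linear_combination (-(powerSum i r m) * z ^ (D.d i * 2)) * key

theorem character_braidWord (hq : ∀ n : ℕ, 0 < n → q ^ n ≠ 1) (l : List I) (m : Mon I)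
    (a : CartanAlg I) :
    character D q hbar (braidMonWord D q l m) (braidCartanWord D q l a) =
      character D q hbar m a := by
  induction l with
  | nil => rfl
  | cons i l ih =>
    have h1 : braidMonWord D q (i :: l) m = braidMon D q i (braidMonWord D q l m) := rfl
    have h2 : braidCartanWord D q (i :: l) a = braidCartan D q i (braidCartanWord D q l a) := rfl
    rw [h1, h2, character_braid D hbar hq, ih]

end Datum

/-! ### Characters of the Cartan–Drinfeld algebra and their values on the `φ` series -/

open PowerSeries in
theorem constantCoeff_smul_hSeries {I : Type*} (e : ℤˣ) (i : I) (c : ℂ) :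
    constantCoeff (c • hSeries e i) = 0 := by
  rw [← coeff_zero_eq_constantCoeff_apply, coeff_smul, hSeries, coeff_mk]
  simp

section Datum

open PowerSeries

variable {I : Type*} [Fintype I] [DecidableEq I] (D : CartanDatum I) {q : ℂˣ} (hbar : ℂ)

variable (q) in
/-- The image of the exponent of `phiSeries` under a character. -/
def logPhi (χ : CartanAlg I →ₐ[ℂ] ℂ) (e : ℤˣ) (i : I) : ℂ⟦X⟧ :=
  PowerSeries.map (χ : CartanAlg I →+* ℂ)
    ((((e : ℤ) : ℂ) * ((qi D q i : ℂ) - (qi D q i : ℂ)⁻¹)) • hSeries e i)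

theorem constantCoeff_logPhi (χ : CartanAlg I →ₐ[ℂ] ℂ) (e : ℤˣ) (i : I) :
    constantCoeff (logPhi D q χ e i) = 0 := by
  rw [← coeff_zero_eq_constantCoeff_apply, logPhi, coeff_map, coeff_zero_eq_constantCoeff_apply,
    constantCoeff_smul_hSeries, map_zero]

theorem coeff_logPhi (χ : CartanAlg I →ₐ[ℂ] ℂ) (e : ℤˣ) (i : I) {n : ℕ} (hn : n ≠ 0) :
    coeff n (logPhi D q χ e i) = ((e : ℤ) : ℂ) * ((qi D q i : ℂ) - (qi D q i : ℂ)⁻¹) *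
      χ (hgen i ⟨(e : ℤ) * n, mul_ne_zero e.ne_zero (Int.natCast_ne_zero.mpr hn)⟩) := by
  rw [logPhi, coeff_map, coeff_smul, hSeries, coeff_mk, dif_neg hn]
  exact map_smul χ _ _

theorem map_phiSeries (χ : CartanAlg I →ₐ[ℂ] ℂ) (e : ℤˣ) (i : I) :
    PowerSeries.map (χ : CartanAlg I →+* ℂ) (phiSeries D q e i) =
      C (χ (kwt ((e : ℤ) • simpleRoot D i))) * expS (logPhi D q χ e i) := by
  rw [phiSeries, map_mul, map_exp_subst χ (constantCoeff_smul_hSeries e i _), map_C]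
  rfl

/-- A character is determined by its values on the `k̄_j` and on the `φ^±_{i,n}`. -/
theorem eq_of_map_phiSeries_eq (hq : ∀ n : ℕ, 0 < n → q ^ n ≠ 1) {χ χ' : CartanAlg I →ₐ[ℂ] ℂ}
    (hk : ∀ lam, χ (kwt lam) = χ' (kwt lam))
    (hphi : ∀ e i, PowerSeries.map (χ : CartanAlg I →+* ℂ) (phiSeries D q e i) =
      PowerSeries.map (χ' : CartanAlg I →+* ℂ) (phiSeries D q e i)) : χ = χ' := by
  refine algHom_ext_kwt_hgen hk fun i r => ?_
  obtain ⟨e, n, hn, hr⟩ : ∃ (e : ℤˣ) (n : ℕ), n ≠ 0 ∧ (r : ℤ) = (e : ℤ) * n := by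
    have := r.2
    rcases Int.natAbs_eq (r : ℤ) with h | h
    · exact ⟨1, (r : ℤ).natAbs, by omega, by simpa using h⟩
    · exact ⟨-1, (r : ℤ).natAbs, by omega, by simpa using h⟩
  have hr' : r = ⟨(e : ℤ) * n, mul_ne_zero e.ne_zero (Int.natCast_ne_zero.mpr hn)⟩ :=
    Subtype.ext hr
  have h := hphi e i
  -- The value of a character on a torus element is invertible, so it can be cancelled, leaving
  -- exponentials to compare.
  have hne : C (χ' (kwt ((e : ℤ) • simpleRoot D i))) ≠ 0 := by
    intro h0
    have h1 : χ' (kwt ((e : ℤ) • simpleRoot D i)) * χ' (kwt (-((e : ℤ) • simpleRoot D i))) = 1 := by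
      rw [← map_mul, ← kwt_add, add_neg_cancel]
      exact map_one χ'
    rw [(map_eq_zero_iff C C_injective).mp h0, zero_mul] at h1
    exact zero_ne_one h1
  rw [map_phiSeries, map_phiSeries, hk] at h
  have hl := expS_injective (constantCoeff_logPhi D χ e i) (constantCoeff_logPhi D χ' e i)
    (mul_left_cancel₀ hne h)
  have hc := congrArg (coeff n) hl
  rw [coeff_logPhi D χ e i hn, coeff_logPhi D χ' e i hn, ← hr'] at hc
  exact mul_left_cancel₀ (mul_ne_zero (Int.cast_ne_zero.mpr e.ne_zero)
    (sub_inv_ne_zero (qi_not_root_of_unity D hq i))) hc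

/-! ### The values of `character` on the `φ^±_{i,n}` -/

variable (q) in
/-- The series of values of the character of `m` on the `φ^±_{i,n}`. -/
def phiChar (m : Mon I) (e : ℤˣ) (i : I) : ℂ⟦X⟧ :=
  PowerSeries.map (character D q hbar m : CartanAlg I →+* ℂ) (phiSeries D q e i)

/-- The values on the `h_{i,r}` are additive in the monomial and those on the torus multiplicative;
the exponential makes the whole multiplicative. -/
theorem phiChar_mul (m m' : Mon I) (e : ℤˣ) (i : I) :
    phiChar D q hbar (m * m') e i = phiChar D q hbar m e i * phiChar D q hbar m' e i := by
  have h : logPhi D q (character D q hbar (m * m')) e i =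
      logPhi D q (character D q hbar m) e i + logPhi D q (character D q hbar m') e i := by
    ext n
    rw [map_add]
    rcases eq_or_ne n 0 with rfl | hn
    · simp only [coeff_zero_eq_constantCoeff_apply, constantCoeff_logPhi, add_zero]
    · simp only [coeff_logPhi D _ e i hn, character_hgen, powerSum_mul]
      ring
  rw [phiChar, phiChar, phiChar, map_phiSeries, map_phiSeries, map_phiSeries, h,
    expS_add (constantCoeff_logPhi D _ e i) (constantCoeff_logPhi D _ e i), character_kwt,
    character_kwt, character_kwt, wt_mul, qform_add_right, map_mul]
  ring

theorem phiChar_one (e : ℤˣ) (i : I) : phiChar D q hbar 1 e i = 1 := by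
  have h : logPhi D q (character D q hbar 1) e i = 0 := by
    ext n
    rw [map_zero]
    rcases eq_or_ne n 0 with rfl | hn
    · simp only [coeff_zero_eq_constantCoeff_apply, constantCoeff_logPhi]
    · rw [coeff_logPhi D _ e i hn, character_hgen, powerSum_one, mul_zero, mul_zero]
  rw [phiChar, map_phiSeries, h, expS_zero, character_kwt, wt_one, qform_zero_right, map_one,
    mul_one]

theorem phiChar_mul_inv (m : Mon I) (e : ℤˣ) (i : I) :
    phiChar D q hbar m e i * phiChar D q hbar m⁻¹ e i = 1 := by
  rw [← phiChar_mul, mul_inv_cancel, phiChar_one]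

theorem qform_smul_simpleRoot (hexp : (q : ℂ) = Complex.exp hbar) (e : ℤ) (i : I) (mu : I → ℤ) :
    qform D hbar (e • simpleRoot D i) mu = ((qi D q i : ℂ) ^ mu i) ^ e := by
  rw [← qform_simpleRoot D hbar hexp, qform, qform, form_smul_left, ← Complex.exp_int_mul]
  push_cast
  congr 1
  ring

theorem phiChar_Y_of_ne (hexp : (q : ℂ) = Complex.exp hbar) {i k : I} (h : k ≠ i) (a : ℂˣ)
    (e : ℤˣ) : phiChar D q hbar (Y k a) e i = 1 := by
  have h0 : logPhi D q (character D q hbar (Y k a)) e i = 0 := by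
    ext n
    rw [map_zero]
    rcases eq_or_ne n 0 with rfl | hn
    · simp only [coeff_zero_eq_constantCoeff_apply, constantCoeff_logPhi]
    · rw [coeff_logPhi D _ e i hn, character_hgen, powerSum_Y, if_neg h, mul_zero, mul_zero]
  rw [phiChar, map_phiSeries, h0, expS_zero, character_kwt, qform_smul_simpleRoot D hbar hexp, wt_Y]
  simp [Ne.symm h]

/-- The factor `q_i - q_i⁻¹` cancels the denominator of the quantum integer, so the exponent is a
difference of two logarithms of linear factors. -/
theorem phiChar_Y (hexp : (q : ℂ) = Complex.exp hbar) (hq : ∀ n : ℕ, 0 < n → q ^ n ≠ 1) (i : I)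
    (a : ℂˣ) (e : ℤˣ) :
    phiChar D q hbar (Y i a) e i * (1 - C ((a * qi D q i : ℂ) ^ (e : ℤ)) * X) =
      C ((qi D q i : ℂ) ^ (e : ℤ)) * (1 - C ((a * (qi D q i : ℂ)⁻¹) ^ (e : ℤ)) * X) := by
  set b := (a * qi D q i : ℂ) ^ (e : ℤ) with hb
  set b' := (a * (qi D q i : ℂ)⁻¹) ^ (e : ℤ) with hb'
  have hl : logPhi D q (character D q hbar (Y i a)) e i = logGeom b + -logGeom b' := by
    ext n
    rw [map_add, map_neg]
    rcases eq_or_ne n 0 with rfl | hn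
    · simp only [coeff_zero_eq_constantCoeff_apply, constantCoeff_logPhi, constantCoeff_logGeom,
        neg_zero, add_zero]
    · have hsub := sub_inv_ne_zero (qi_not_root_of_unity D hq i)
      have hn' : (n : ℂ) ≠ 0 := Nat.cast_ne_zero.mpr hn
      rw [coeff_logPhi D _ e i hn, character_hgen, powerSum_Y, if_pos rfl, logGeom, logGeom,
        coeff_mk, coeff_mk, qint, hb, hb', ← zpow_natCast, ← zpow_natCast, ← zpow_mul, ← zpow_mul,
        mul_zpow, mul_zpow, inv_zpow, ← zpow_neg]
      have he : ((e : ℤ) : ℂ) ≠ 0 := Int.cast_ne_zero.mpr e.ne_zero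
      push_cast
      generalize (qi D q i : ℂ) - (qi D q i : ℂ)⁻¹ = s at hsub ⊢
      generalize (qi D q i : ℂ) ^ ((e : ℤ) * (n : ℤ)) = x
      generalize (qi D q i : ℂ) ^ (-((e : ℤ) * (n : ℤ))) = y
      field_simp
      ring
  rw [phiChar, map_phiSeries, hl, expS_add (constantCoeff_logGeom b)
    (by rw [map_neg, constantCoeff_logGeom, neg_zero]), expS_neg_logGeom, character_kwt,
    qform_smul_simpleRoot D hbar hexp, wt_Y, Pi.single_eq_same, zpow_one]
  linear_combination (C ((qi D q i : ℂ) ^ (e : ℤ)) * (1 - C b' * X)) * expS_logGeom_mul b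

theorem lWeight_Y_of_ne {i k : I} (h : k ≠ i) (a : ℂˣ) : (lWeight D q (Y k a) i : ℂ⟦X⟧) = 1 := by
  rw [lWeight, monLift_Y]
  simp [prefund, constLWeight, Ne.symm h]

theorem lWeight_Y (i : I) (a : ℂˣ) :
    (lWeight D q (Y i a) i : ℂ⟦X⟧) * (1 - C (a * qi D q i : ℂ) * X) =
      C (qi D q i : ℂ) * (1 - C (a * (qi D q i : ℂ)⁻¹) * X) := by
  have h1 : ((linUnit (a * qi D q i : ℂˣ) : (ℂ⟦X⟧)ˣ) : ℂ⟦X⟧) = 1 - C (a * qi D q i : ℂ) * X := rfl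
  have h2 : ((linUnit (a * (qi D q i)⁻¹ : ℂˣ) : (ℂ⟦X⟧)ˣ) : ℂ⟦X⟧) =
      1 - C (a * (qi D q i : ℂ)⁻¹) * X := by
    rw [← Units.val_inv_eq_inv_val]
    rfl
  rw [← h1, ← h2, lWeight, monLift_Y]
  simp only [Pi.mul_apply, Pi.inv_apply, prefund, Pi.mulSingle_eq_same, constLWeight,
    Pi.single_eq_same, zpow_one, Units.val_mul]
  rw [mul_assoc, Units.inv_mul, mul_one]
  rfl

theorem lWeight_eq_phiChar (hexp : (q : ℂ) = Complex.exp hbar) (hq : ∀ n : ℕ, 0 < n → q ^ n ≠ 1)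
    (m : Mon I) (i : I) : (lWeight D q m i : ℂ⟦X⟧) = phiChar D q hbar m 1 i := by
  induction m using mon_induction with
  | one => rw [map_one, phiChar_one, Pi.one_apply, Units.val_one]
  | mul m m' h h' => rw [map_mul, Pi.mul_apply, Units.val_mul, h, h', phiChar_mul]
  | inv m h =>
    have h1 := phiChar_mul_inv D hbar m 1 i (q := q)
    rw [← h] at h1
    rw [map_inv, Pi.inv_apply]
    exact Units.inv_eq_of_mul_eq_one_right h1
  | gen k a =>
    by_cases hk : k = i
    · subst hk
      have h1 := lWeight_Y D (q := q) k a
      have h2 := phiChar_Y D hbar hexp hq k a 1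
      simp only [Units.val_one, zpow_one] at h2
      rw [← h2] at h1
      refine mul_right_cancel₀ (b := 1 - C (a * qi D q k : ℂ) * X) ?_ h1
      intro h0
      have := congrArg constantCoeff h0
      simp at this
    · rw [lWeight_Y_of_ne D hk, phiChar_Y_of_ne D hbar hexp hk]

theorem isBalanced_phiChar (hexp : (q : ℂ) = Complex.exp hbar) (hq : ∀ n : ℕ, 0 < n → q ^ n ≠ 1)
    (m : Mon I) (i : I) : IsBalanced (phiChar D q hbar m 1 i) (phiChar D q hbar m (-1) i) := by
  have one : IsBalanced 1 1 := ⟨0, 1, 1, by simp, by simp, one_ne_zero, by simp, by simp⟩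
  induction m using mon_induction with
  | one => rwa [phiChar_one, phiChar_one]
  | mul m m' h h' => rw [phiChar_mul, phiChar_mul]; exact h.mul h'
  | inv m h => exact h.inv (phiChar_mul_inv D hbar m 1 i) (phiChar_mul_inv D hbar m (-1) i)
  | gen k a =>
    by_cases hk : k = i
    · subst hk
      have hp := phiChar_Y D hbar hexp hq k a 1
      have hm := phiChar_Y D hbar hexp hq k a (-1)
      have ha : (a : ℂ) ≠ 0 := a.ne_zero
      have hqk : (qi D q k : ℂ) ≠ 0 := (qi D q k).ne_zero
      simp only [Units.val_one, zpow_one, Units.val_neg, zpow_neg, mul_inv, inv_inv] at hp hm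
      -- Rewrite `q_k (1 - z a q_k⁻¹) / (1 - z a q_k)` in `w = z⁻¹`: it is `q_k⁻¹ (1 - w a⁻¹ q_k) /
      -- (1 - w a⁻¹ q_k⁻¹)`.
      refine ⟨1, 1 - Polynomial.C ((a : ℂ)⁻¹ * (qi D q k : ℂ)⁻¹) * Polynomial.X,
        Polynomial.C (qi D q k : ℂ)⁻¹ *
          (1 - Polynomial.C ((a : ℂ)⁻¹ * (qi D q k : ℂ)) * Polynomial.X), ?_, ?_, ?_, ?_, ?_⟩
      · compute_degree
      · compute_degree
      · intro h0
        have := congrArg (Polynomial.coeff · 0) h0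
        simp at this
      · simp only [Polynomial.coe_sub, Polynomial.coe_mul, Polynomial.coe_one, Polynomial.coe_C,
          Polynomial.coe_X]
        rw [mul_comm, hm]
      · simp only [Polynomial.reflect_sub, Polynomial.reflect_C_mul, Polynomial.reflect_one,
          Polynomial.reflect_one_X, pow_one, mul_one, Polynomial.coe_sub, Polynomial.coe_mul,
          Polynomial.coe_C, Polynomial.coe_X]
        simp only [map_mul] at hp ⊢
        have ha' : (C (a : ℂ) : ℂ⟦X⟧) * C (a : ℂ)⁻¹ = 1 := by
          rw [← map_mul, mul_inv_cancel₀ ha, map_one]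
        have hq' : (C (qi D q k : ℂ) : ℂ⟦X⟧) * C (qi D q k : ℂ)⁻¹ = 1 := by
          rw [← map_mul, mul_inv_cancel₀ hqk, map_one]
        linear_combination (-(C (a : ℂ)⁻¹ * C (qi D q k : ℂ)⁻¹)) * hp -
          (X * phiChar D q hbar (Y k a) 1 k - C (qi D q k : ℂ)⁻¹ * X) *
            (ha' + C (a : ℂ) * C (a : ℂ)⁻¹ * hq')
    · rw [phiChar_Y_of_ne D hbar hexp hk, phiChar_Y_of_ne D hbar hexp hk]
      exact one

end Datum

/-! ### Common eigenvectors of commuting operators -/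

section CommonEigenvector

variable {K V ι : Type*} [Field K] [IsAlgClosed K] [AddCommGroup V] [Module K V]
  [FiniteDimensional K V]

/-- A commuting family of operators has a common eigenvector in each nonzero stable subspace. -/
theorem exists_common_eigenvector (f : ι → Module.End K V) (hf : ∀ i j, Commute (f i) (f j))
    {U : Submodule K V} (hU : U ≠ ⊥) (hs : ∀ i, ∀ v ∈ U, f i v ∈ U) :
    ∃ v ∈ U, v ≠ 0 ∧ ∀ i, ∃ c : K, f i v = c • v := by
  let S : Set (Submodule K V) := {U' | U' ≠ ⊥ ∧ U' ≤ U ∧ ∀ i, ∀ v ∈ U', f i v ∈ U'}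
  -- In a minimal nonzero stable subspace, an eigenspace of any one operator is again stable, hence
  -- everything. So any nonzero vector of it works, however large the family.
  obtain ⟨U', ⟨h0, hle, hst⟩, hmin⟩ :=
    (wellFounded_lt (α := Submodule K V)).has_min S ⟨U, hU, le_rfl, hs⟩
  obtain ⟨v, hv, hv0⟩ := U'.ne_bot_iff.mp h0
  refine ⟨v, hle hv, hv0, fun i => ?_⟩
  have : Nontrivial U' := U'.nontrivial_iff_ne_bot.mpr h0
  obtain ⟨c, hc⟩ := Module.End.exists_eigenvalue ((f i).restrict (hst i))
  obtain ⟨w, hw⟩ := hc.exists_hasEigenvector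
  have hw1 : f i w = c • (w : V) := congrArg Subtype.val hw.apply_eq_smul
  have hw0 : (w : V) ≠ 0 := fun h => hw.2 (Subtype.ext h)
  have hmem : U' ⊓ (f i).eigenspace c ∈ S := by
    refine ⟨(Submodule.ne_bot_iff _).mpr ⟨w, ⟨w.2, Module.End.mem_eigenspace_iff.mpr hw1⟩, hw0⟩,
      inf_le_left.trans hle, ?_⟩
    rintro j x ⟨hx, hx'⟩
    refine ⟨hst j x hx, Module.End.mem_eigenspace_iff.mpr ?_⟩
    rw [← Module.End.mul_apply, (hf i j).eq, Module.End.mul_apply,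
      Module.End.mem_eigenspace_iff.mp hx', map_smul]
  have heq : U' ⊓ (f i).eigenspace c = U' :=
    eq_of_le_of_not_lt inf_le_left (hmin _ hmem)
  rw [← heq] at hv
  exact ⟨c, Module.End.mem_eigenspace_iff.mp hv.2⟩

/-- A stable subspace on which the common eigenvectors have only the eigenvalue `c` for one of the
operators lies in the generalized eigenspace of `c`. -/
theorem le_maxGenEigenspace_of_common_eigenvector (f : ι → Module.End K V)
    (hf : ∀ i j, Commute (f i) (f j)) {W : Submodule K V} (hs : ∀ i, ∀ v ∈ W, f i v ∈ W) (i : ι)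
    (c : K)
    (hc : ∀ v ∈ W, v ≠ 0 → (∀ j, ∃ t : K, f j v = t • v) → f i v = c • v) :
    W ≤ (f i).maxGenEigenspace c := by
  -- A stable `W` is the sum of its intersections with the generalized eigenspaces. For `μ ≠ c` the
  -- intersection is stable under the family, and a common eigenvector in it would have eigenvalue
  -- `c`.
  have h1 := Submodule.inf_iSup_genEigenspace (hs i) ⊤ (p := W)
  have htop : ⨆ μ, (f i).genEigenspace μ ⊤ = ⊤ := Module.End.iSup_maxGenEigenspace_eq_top (f i)
  rw [htop, inf_top_eq] at h1
  rw [h1]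
  refine iSup_le fun μ => ?_
  by_cases hμ : μ = c
  · rw [hμ]
    exact inf_le_right
  suffices h : W ⊓ (f i).genEigenspace μ ⊤ = ⊥ by rw [h]; exact bot_le
  by_contra hne
  obtain ⟨v, ⟨hvW, hvμ⟩, hv0, hv⟩ := exists_common_eigenvector f hf hne fun j v hv =>
    ⟨hs j v hv.1, Module.End.mapsTo_maxGenEigenspace_of_comm (hf i j) μ hv.2⟩
  have hvc : v ∈ (f i).genEigenspace c ⊤ :=
    (f i).genEigenspace c |>.monotone (le_top (a := (1 : ℕ∞)))
      (Module.End.mem_eigenspace_iff.mpr (hc v hvW hv0 hv))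
  exact hv0 ((Submodule.disjoint_def.mp ((f i).disjoint_genEigenspace hμ ⊤ ⊤)) v hvμ hvc)

end CommonEigenvector

/-! ### Finite-dimensional modules of the quantum affine algebra -/

section Modules

variable {I : Type*} [Fintype I] [DecidableEq I] {D : CartanDatum I} {q : ℂˣ} (hbar : ℂ)
variable {V : Type*} [AddCommGroup V] [Module ℂ V] (ρ : QuantumAffine D q →ₐ[ℂ] Module.End ℂ V)

/-- `act` as a homomorphism of algebras. -/
def actHom : CartanAlg I →ₐ[ℂ] Module.End ℂ V := ρ.comp (cartanMap D q)

theorem actHom_apply (a : CartanAlg I) : actHom ρ a = act ρ a := rfl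

theorem act_commute (a b : CartanAlg I) : Commute (act ρ a) (act ρ b) := by
  rw [← actHom_apply, ← actHom_apply]
  exact (Commute.all a b).map (actHom ρ)

/-- A common eigenvector of `U_q(ĥ)` defines a character. -/
theorem exists_character {v : V} (hv : v ≠ 0) (h : ∀ a, ∃ t : ℂ, act ρ a v = t • v) :
    ∃ χ : CartanAlg I →ₐ[ℂ] ℂ, ∀ a, act ρ a v = χ a • v := by
  choose t ht using h
  have hinj : ∀ {s s' : ℂ}, s • v = s' • v → s = s' := fun h => smul_left_injective ℂ hv h
  have hC : ∀ s : ℂ, t (algebraMap ℂ _ s) = s := fun s => hinj <| by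
    rw [← ht, ← actHom_apply, AlgHom.commutes, Module.algebraMap_end_apply]
  refine ⟨{ toFun := t, map_one' := ?_, map_mul' := fun a b => hinj ?_, map_zero' := ?_,
            map_add' := fun a b => hinj ?_, commutes' := hC }, ht⟩
  · have h := hC 1
    rwa [map_one] at h
  · rw [← ht, ← actHom_apply, map_mul, Module.End.mul_apply, actHom_apply, actHom_apply, ht,
      map_smul, ht, smul_smul, mul_comm]
  · have h := hC 0
    rwa [map_zero] at h
  · rw [← ht, ← actHom_apply, map_add, LinearMap.add_apply, actHom_apply, actHom_apply, ht, ht,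
      add_smul]

section Recurrence

variable (D q) in
/-- The image of `x^±_{i,r}` in `U_q(ĝ)`. -/
def xgen (e : ℤˣ) (i : I) (r : ℤ) : QuantumAffine D q :=
  RingQuot.mkAlgHom ℂ (DrinfeldRel D q) (fx e i r)

theorem cartanMap_hgen_one_commutator (i : I) (r : ℤ) :
    cartanMap D q (hgen i ⟨1, one_ne_zero⟩) * xgen D q 1 i r -
      xgen D q 1 i r * cartanMap D q (hgen i ⟨1, one_ne_zero⟩) =
        qint (qi D q i) 2 • xgen D q 1 i (r + 1) := by
  have h := RingQuot.mkAlgHom_rel ℂ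
    (DrinfeldRel.h_x (D := D) (q := q) i ⟨1, one_ne_zero⟩ 1 i r)
  simp only [map_sub, map_mul, map_smul, D.diag, Units.val_one, Int.cast_one, one_mul, div_one,
    add_comm 1 r] at h
  exact h

theorem smul_cartanMap_phi (hq : ∀ n : ℕ, 0 < n → q ^ n ≠ 1) (i : I) (r s : ℤ) :
    cartanMap D q (phi D q 1 i (r + s) - phi D q (-1) i (r + s)) =
      ((qi D q i : ℂ) - (qi D q i : ℂ)⁻¹) •
        (xgen D q 1 i r * xgen D q (-1) i s - xgen D q (-1) i s * xgen D q 1 i r) := by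
  have h := RingQuot.mkAlgHom_rel ℂ (DrinfeldRel.x_x_opp (D := D) (q := q) i i r s)
  rw [if_pos rfl, map_smul, map_sub, map_mul, map_mul] at h
  have hne := sub_inv_ne_zero (qi_not_root_of_unity D hq i)
  change xgen D q 1 i r * xgen D q (-1) i s - xgen D q (-1) i s * xgen D q 1 i r =
    _ • cartanMap D q _ at h
  rw [h, smul_smul, mul_inv_cancel₀ hne, one_smul]

/-- On a finite-dimensional module, the `φ^+_{i,n} - φ^-_{i,n}` satisfy a linear recurrence. -/
theorem exists_recurrence [FiniteDimensional ℂ V] (hq : ∀ n : ℕ, 0 < n → q ^ n ≠ 1) (i : I) :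
    ∃ P : Polynomial ℂ, P ≠ 0 ∧ ∀ n : ℤ, ∑ k ∈ Finset.range (P.natDegree + 1), P.coeff k •
      act ρ (phi D q 1 i (n + k) - phi D q (-1) i (n + k)) = 0 := by
  set H := act ρ (hgen i ⟨1, one_ne_zero⟩) with hH
  set c := qint (qi D q i : ℂ) 2 with hc
  have hc0 : c ≠ 0 := by
    have := qint_ne_zero (qi D q i) (qi_not_root_of_unity D hq i) 2 two_pos
    exact_mod_cast this
  let X : ℤ → Module.End ℂ V := fun r => ρ (xgen D q 1 i r)
  -- `T` acts on the finite-dimensional space `End V`, so it has a minimal polynomial; since it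
  -- shifts the `X r`, this one polynomial gives the recurrence from every starting index.
  let T : Module.End ℂ (Module.End ℂ V) :=
    c⁻¹ • (LinearMap.mulLeft ℂ H - LinearMap.mulRight ℂ H)
  have hT : ∀ r, T (X r) = X (r + 1) := by
    intro r
    have h := congrArg ρ (cartanMap_hgen_one_commutator (D := D) (q := q) i r)
    rw [map_sub, map_mul, map_mul, map_smul] at h
    change c⁻¹ • (H * X r - X r * H) = X (r + 1)
    rw [show H * X r - X r * H = c • X (r + 1) from h, smul_smul, inv_mul_cancel₀ hc0, one_smul]
  have hTk : ∀ (k : ℕ) (r : ℤ), (T ^ k) (X r) = X (r + k) := by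
    intro k
    induction k with
    | zero => simp
    | succ k ih =>
      intro r
      rw [pow_succ', Module.End.mul_apply, ih, hT]
      push_cast
      rw [add_assoc]
  refine ⟨minpoly ℂ T, minpoly.ne_zero (Algebra.IsIntegral.isIntegral T), fun n => ?_⟩
  have h0 : ∑ k ∈ Finset.range ((minpoly ℂ T).natDegree + 1), (minpoly ℂ T).coeff k • X (n + k) =
      0 := by
    have h := congrArg (fun S : Module.End ℂ (Module.End ℂ V) => S (X n)) (minpoly.aeval ℂ T)
    rw [Polynomial.aeval_eq_sum_range] at h
    simpa [LinearMap.sum_apply, hTk] using h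
  let Y := ρ (xgen D q (-1) i 0)
  -- The linear map `L`, a multiple of the bracket with `x^-_{i,0}`, carries the recurrence from
  -- `x^+_{i,r}` to `φ^+_{i,r} - φ^-_{i,r}`.
  let L : Module.End ℂ (Module.End ℂ V) :=
    ((qi D q i : ℂ) - (qi D q i : ℂ)⁻¹) • (LinearMap.mulRight ℂ Y - LinearMap.mulLeft ℂ Y)
  have hphi : ∀ r : ℤ, act ρ (phi D q 1 i r - phi D q (-1) i r) = L (X r) := by
    intro r
    have h := congrArg ρ (smul_cartanMap_phi hq i r 0 (D := D))
    rwa [add_zero, map_smul, map_sub ρ (_ * _), map_mul, map_mul] at h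
  simp only [hphi, ← map_smul, ← map_sum, h0, map_zero]

end Recurrence

theorem apply_phi (χ : CartanAlg I →ₐ[ℂ] ℂ) (e : ℤˣ) (i : I) (n : ℤ) :
    χ (phi D q e i n) = if 0 ≤ (e : ℤ) * n then
      PowerSeries.coeff n.natAbs (PowerSeries.map (χ : CartanAlg I →+* ℂ) (phiSeries D q e i))
      else 0 := by
  rw [phi]
  split_ifs
  · rfl
  · exact map_zero χ

/-- The eigenvalues of the `φ^+_{i,n}` and of the `φ^-_{i,n}` on a common eigenvector are given by
the expansions of one rational function. -/
theorem isBalanced_of_eigenvector [FiniteDimensional ℂ V] (hq : ∀ n : ℕ, 0 < n → q ^ n ≠ 1)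
    {v : V} (hv : v ≠ 0) {χ : CartanAlg I →ₐ[ℂ] ℂ} (hχ : ∀ a, act ρ a v = χ a • v) (i : I) :
    IsBalanced (PowerSeries.map (χ : CartanAlg I →+* ℂ) (phiSeries D q 1 i))
      (PowerSeries.map (χ : CartanAlg I →+* ℂ) (phiSeries D q (-1) i)) := by
  obtain ⟨P, hP, h⟩ := exists_recurrence ρ hq i
  refine isBalanced_of_recurrence hP fun n => smul_left_injective ℂ hv ?_
  have h1 := congrArg (fun S : Module.End ℂ V => S v) (h n)
  simp only [LinearMap.sum_apply, LinearMap.smul_apply, hχ, smul_smul, ← Finset.sum_smul, map_sub,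
    apply_phi, Units.val_one, Units.val_neg, one_mul, neg_mul, Left.nonneg_neg_iff,
    LinearMap.zero_apply] at h1
  simpa only [zero_smul] using h1

/-- The joint generalized eigenspaces of the `k̄_j` are independent. If no weight gave the
eigenvalues on `v`, the weight spaces would all lie in joint eigenspaces other than that of `v`, yet
they span `V`. -/
theorem weight_of_eigenvector (htype : IsTypeOne hbar ρ) {v : V} (hv : v ≠ 0)
    {χ : CartanAlg I →ₐ[ℂ] ℂ} (hχ : ∀ a, act ρ a v = χ a • v) :
    ∃ lam : I → ℤ, ∀ mu, χ (kwt mu) = qform D hbar mu lam := by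
  have hind := Module.End.independent_iInf_maxGenEigenspace_of_forall_mapsTo
    (fun j : I => act ρ (kwt (Pi.single j 1))) fun i j φ =>
      Module.End.mapsTo_maxGenEigenspace_of_comm (act_commute ρ _ _) φ
  obtain ⟨lam, hlam⟩ : ∃ lam : I → ℤ, (fun j => qform D hbar (Pi.single j 1) lam) =
      fun j => χ (kwt (Pi.single j 1)) := by
    by_contra! hne
    have hle : ∀ (j : I) (c : ℂ), (act ρ (kwt (Pi.single j 1))).eigenspace c ≤
        (act ρ (kwt (Pi.single j 1))).maxGenEigenspace c := fun j c =>
      ((act ρ (kwt (Pi.single j 1))).genEigenspace c).monotone (le_top (a := (1 : ℕ∞)))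
    refine hv (Submodule.disjoint_def.mp (hind fun j => χ (kwt (Pi.single j 1))) v ?_ ?_)
    · refine Submodule.mem_iInf _ |>.mpr fun j => hle j _ ?_
      exact Module.End.mem_eigenspace_iff.mpr (hχ _)
    · have htop : v ∈ ⨆ lam, weightSpace hbar ρ lam := by rw [htype]; trivial
      refine (iSup_le fun lam => ?_ : (⨆ lam, weightSpace hbar ρ lam) ≤ _) htop
      refine le_iSup₂_of_le (fun j => qform D hbar (Pi.single j 1) lam) (hne lam) ?_
      exact iInf_mono fun j => hle j _
  refine ⟨lam, fun mu => ?_⟩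
  let F : (I → ℤ) →+ Additive ℂ :=
    { toFun := fun mu => Additive.ofMul (χ (kwt mu))
      map_zero' := congrArg Additive.ofMul (map_one χ)
      map_add' := fun mu mu' => by rw [kwt_add, map_mul, ofMul_mul] }
  let G : (I → ℤ) →+ Additive ℂ :=
    { toFun := fun mu => Additive.ofMul (qform D hbar mu lam)
      map_zero' := congrArg Additive.ofMul (by simp [qform, form])
      map_add' := fun mu mu' => by rw [qform_add_left, ofMul_mul] }
  have hFG : F = G := AddMonoidHom.functions_ext' _ _ _ fun j =>
    AddMonoidHom.ext_int (congrFun hlam j).symm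
  exact congrArg (fun S : (I → ℤ) →+ Additive ℂ => (S mu).toMul) hFG

theorem zpow_injective_of_not_root_of_unity {z : ℂˣ} (hz : ∀ n : ℕ, 0 < n → z ^ n ≠ 1) {r s : ℤ}
    (h : (z : ℂ) ^ r = (z : ℂ) ^ s) : r = s := by
  by_contra hne
  have h1 : (z : ℂ) ^ (r - s) = 1 := by
    rw [zpow_sub₀ z.ne_zero, h, div_self (zpow_ne_zero _ z.ne_zero)]
  refine zpow_sub_zpow_neg_ne_zero hz (sub_ne_zero.mpr hne) ?_
  rw [zpow_neg, h1, inv_one, sub_self]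

theorem eq_character_of_eigenvector [FiniteDimensional ℂ V] (hexp : (q : ℂ) = Complex.exp hbar)
    (hq : ∀ n : ℕ, 0 < n → q ^ n ≠ 1) (htype : IsTypeOne hbar ρ) {v : V} (hv : v ≠ 0)
    {χ : CartanAlg I →ₐ[ℂ] ℂ} (hχ : ∀ a, act ρ a v = χ a • v) {m : Mon I}
    (hm : v ∈ lWeightSpace ρ m) : χ = character D q hbar m := by
  have hplus : ∀ i, PowerSeries.map (χ : CartanAlg I →+* ℂ) (phiSeries D q 1 i) =
      phiChar D q hbar m 1 i := by
    intro i
    rw [← lWeight_eq_phiChar D hbar hexp hq]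
    obtain ⟨p, hp⟩ := hm
    ext n
    set t := PowerSeries.coeff n (lWeight D q m i : ℂ⟦X⟧)
    have hpow : ∀ k : ℕ, ((act ρ (phi D q 1 i n) - algebraMap ℂ (Module.End ℂ V) t) ^ k) v =
        (χ (phi D q 1 i n) - t) ^ k • v := by
      intro k
      induction k with
      | zero => simp
      | succ k ih =>
        rw [pow_succ', Module.End.mul_apply, ih, map_smul, LinearMap.sub_apply, hχ,
          Module.algebraMap_end_apply, ← sub_smul, smul_smul, ← pow_succ]
    have h := hp i n
    rw [hpow] at h
    have h0 := sub_eq_zero.mp (eq_zero_of_pow_eq_zero ((smul_eq_zero.mp h).resolve_right hv))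
    rw [apply_phi, if_pos (by simp), Int.natAbs_natCast] at h0
    exact h0
  obtain ⟨lam, hlam⟩ := weight_of_eigenvector hbar ρ htype hv hχ
  -- The constant terms of `φ^+_i` give `q_i^{lam_i} = q_i^{wt(m)_i}`. This fixes `k̄_j` as well,
  -- which the values on the `k_i` alone would not.
  have hwt : lam = wt m := by
    funext i
    have h := congrArg PowerSeries.constantCoeff (hplus i)
    rw [phiChar, map_phiSeries, map_phiSeries, map_mul, map_mul,
      constantCoeff_expS (constantCoeff_logPhi D _ _ _),
      constantCoeff_expS (constantCoeff_logPhi D _ _ _), mul_one, mul_one,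
      PowerSeries.constantCoeff_C, PowerSeries.constantCoeff_C, hlam, character_kwt,
      qform_smul_simpleRoot D hbar hexp, qform_smul_simpleRoot D hbar hexp, Units.val_one,
      zpow_one, zpow_one] at h
    exact zpow_injective_of_not_root_of_unity (qi_not_root_of_unity D hq i) h
  -- For the sign `-`, both series are expansions at `∞` of a rational function with the same
  -- expansion at `0`.
  refine eq_of_map_phiSeries_eq D hq (fun mu => by rw [hlam, character_kwt, hwt]) fun e i => ?_
  rcases Int.units_eq_one_or e with rfl | rfl
  · exact hplus i
  · have h1 := isBalanced_of_eigenvector ρ hq hv hχ i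
    rw [hplus] at h1
    exact h1.eq (isBalanced_phiChar D hbar hexp hq m i)

theorem act_mem_lWeightSpace (a : CartanAlg I) {m : Mon I} {v : V} (hv : v ∈ lWeightSpace ρ m) :
    act ρ a v ∈ lWeightSpace ρ m := by
  obtain ⟨p, hp⟩ := hv
  refine ⟨p, fun i n => ?_⟩
  have hc : Commute ((act ρ (phi D q 1 i n) - algebraMap ℂ (Module.End ℂ V)
      (PowerSeries.coeff n (lWeight D q m i : ℂ⟦X⟧))) ^ p) (act ρ a) :=
    ((act_commute ρ _ _).sub_left (Algebra.commutes _ _)).pow_left p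
  rw [← Module.End.mul_apply, hc.eq, Module.End.mul_apply, hp, map_zero]

theorem lWeightSpace_le_maxGenEigenspace [FiniteDimensional ℂ V]
    (hexp : (q : ℂ) = Complex.exp hbar) (hq : ∀ n : ℕ, 0 < n → q ^ n ≠ 1)
    (htype : IsTypeOne hbar ρ) (m : Mon I) (a : CartanAlg I) :
    lWeightSpace ρ m ≤ (act ρ a).maxGenEigenspace (character D q hbar m a) := by
  refine le_maxGenEigenspace_of_common_eigenvector (act ρ) (act_commute ρ)
    (fun b v hv => act_mem_lWeightSpace ρ b hv) a _ fun v hvW hv0 hv => ?_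
  obtain ⟨χ, hχ⟩ := exists_character ρ hv0 hv
  rw [hχ, eq_character_of_eigenvector hbar ρ hexp hq htype hv0 hχ hvW]

end Modules

end QAff

end

theorem mainTheorem8 {I : Type*} [Fintype I] [DecidableEq I] (D : QAff.CartanDatum I)
    (q : ℂˣ) (hbar : ℂ) (hexp : (q : ℂ) = Complex.exp hbar)
    (hq : ∀ n : ℕ, 0 < n → q ^ n ≠ 1) :
    -- On the space attached to `m` in any type 1 finite-dimensional module, each coefficient of
    -- `h(z)` has the corresponding coefficient of `⟨h(z), m⟩` as its only (generalized) eigenvalue.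
    (∀ (V : Type*) [AddCommGroup V] [Module ℂ V] [FiniteDimensional ℂ V]
      (ρ : QAff.QuantumAffine D q →ₐ[ℂ] Module.End ℂ V), QAff.IsTypeOne hbar ρ →
      ∀ (h : PowerSeries (QAff.CartanAlg I)) (m : QAff.Mon I) (n : ℕ),
        QAff.lWeightSpace ρ m ≤
          Module.End.maxGenEigenspace (QAff.act ρ (PowerSeries.coeff n h))
            (PowerSeries.coeff n (QAff.pairing D q hbar h m))) ∧
    -- The pairing is invariant.
    (∀ w ∈ QAff.weylGroup D, ∀ l : List I, QAff.IsReducedWord D w l →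
      ∀ (h : PowerSeries (QAff.CartanAlg I)) (m : QAff.Mon I),
        QAff.pairing D q hbar (QAff.braidSeriesWord D q l h) (QAff.braidMonWord D q l m) =
          QAff.pairing D q hbar h m) := by
  refine ⟨?_, fun w _ l _ h m => ?_⟩
  · intro V _ _ _ ρ htype h m n
    rw [QAff.pairing, PowerSeries.coeff_map]
    exact QAff.lWeightSpace_le_maxGenEigenspace hbar ρ hexp hq htype m _
  · ext n
    simp only [QAff.pairing, QAff.braidSeriesWord, PowerSeries.coeff_map]
    exact QAff.character_braidWord D hbar hq l m _
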